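/- Let $\omega_0,\epsilon_F>0$. For $T>0$ put $f(x)=1/(e^x+1)$, $n(x)=1/(e^x-1)$, $w(\epsilon)=f(\epsilon/T)[1-f(\epsilon/T)]$ and, for $\epsilon,u\in\mathbb R$, $$\bar K_0(\epsilon,u)=\Big[n\Big(\frac{u-\epsilon}{T}\Big)+f\Big(\frac uT\Big)\Big]\Big(\frac{u-\epsilon}{\omega_0}\Big)^2\operatorname{sgn}(u-\epsilon),$$ $$\bar K_1(\epsilon,u)=\frac{u-\epsilon}{2\epsilon_F}\,\bar K_0(\epsilon,u),\qquad \bar K_2(\epsilon,u)=\frac12\Big(\frac{u-\epsilon}{\omega_0}\Big)^2\bar K_0(\epsilon,u),$$ $\Gamma_0(\epsilon)=\int_{\mathbb R}\bar K_0(\epsilon,u)\,du$, $K=(\bar K_0+\bar K_1-\bar K_2)/\Gamma_0(\epsilon)$. Let $L^2_\sigma=L^2(\mathbb R,d\sigma)$ with $d\sigma(\epsilon)=w(\epsilon)\Gamma_0(\epsilon)\,d\epsilon$ (this space depends on $T$), and consider the integral equation $$\varphi(\epsilon)=\frac1{\Gamma_0(\epsilon)}+\int_{\mathbb R}K(\epsilon,u)\,\varphi(u)\,du\quad\text{for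 a.e. }\epsilon,\qquad \varphi\in L^2_\sigma. \tag{1}$$ Write $\varphi_\pm(\epsilon)=[\varphi(\epsilon)\pm\varphi(-\epsilon)]/2$. For a real $m$ and a function $\Phi$ on $\mathbb R$ that is not a.e. zero and such that $\epsilon\mapsto\Phi(\epsilon/T)$ lies in $L^2_\sigma$ for every $T>0$, say that a family $g=g_T$ has leading contribution $T^{m}\Phi(\epsilon/T)$ as $T\to0^+$ if $$\frac{\|g_T-T^{m}\Phi(\cdot/T)\|_{L^2_\sigma}}{\|T^{m}\Phi(\cdot/T)\|_{L^2_\sigma}}\longrightarrow0\qquad(T\to0^+).$$ Then for all sufficiently small $T>0$ equation (1) has a solution, unique up to a.e. equality. Moreover there are a constant $c$ and a function $\chi$, depending only on $\omega_0$ and $\epsilon_F$, such that for every family $\varphi=\varphi_T$ that solves (1) for all sufficiently small $T>0$: * the leading contribution to $\varphi_+$ as $T\to0^+$ is the constant function $c\,T^{-5}$ (in particular $c\neq0$); * the leading contribution to $\varphi_-$ as $T\to0^+$ is $T^{-4}\chi(\epsilon/T)$ (in particular $\chi$ is not a.e. zero); * whenever $\varphi_+$ and $\varphi_-$ have leading contributions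 $T^{-n_+}\Phi_+(\epsilon/T)$ and $T^{-n_-}\Phi_-(\epsilon/T)$, then $n_+=n_-+1=5$, and $\Phi_+=c$ a.e. -/

import Mathlib

open MeasureTheory Filter Topology

noncomputable section

namespace ElectronPhonon

/-- Fermi distribution function. -/
def fermi (x : ℝ) : ℝ := 1 / (Real.exp x + 1)

/-- Bose distribution function (its value at `0` is irrelevant below, where it only occurs
multiplied by a function that vanishes there). -/
def bose (x : ℝ) : ℝ := 1 / (Real.exp x - 1)

/-- The weight function `w(ε) = f₀(ε/T) [1 - f₀(ε/T)]` at temperature `T`. -/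
def weight (T ε : ℝ) : ℝ := fermi (ε / T) * (1 - fermi (ε / T))

/-- The spectrum of the effective potential for acoustic phonons, `(u/ω₀)² sgn u`. -/
def potential (ω₀ u : ℝ) : ℝ := (u / ω₀) ^ 2 * Real.sign u

/-- The kernel `K̄₀(ε,u) = [n((u-ε)/T) + f(u/T)] V̄₀''(u-ε)`. -/
def Kbar0 (ω₀ T ε u : ℝ) : ℝ :=
  (bose ((u - ε) / T) + fermi (u / T)) * potential ω₀ (u - ε)

/-- The kernel `K̄₁`. -/
def Kbar1 (ω₀ εF T ε u : ℝ) : ℝ :=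
  (ω₀ / (2 * εF)) * (T / ω₀) * ((u - ε) / T) * Kbar0 ω₀ T ε u

/-- The kernel `K̄₂`. -/
def Kbar2 (ω₀ T ε u : ℝ) : ℝ :=
  (1 / 2) * (T / ω₀) ^ 2 * ((u - ε) / T) ^ 2 * Kbar0 ω₀ T ε u

/-- The single-particle relaxation rate `Γ₀(ε) = ∫ K̄₀(ε,u) du`. -/
def Gamma0 (ω₀ T ε : ℝ) : ℝ := ∫ u, Kbar0 ω₀ T ε u

/-- The full kernel `K = K₀ + K₁ - K₂`, where `K_ν(ε,u) = K̄_ν(ε,u) / Γ₀(ε)`. -/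
def K (ω₀ εF T ε u : ℝ) : ℝ :=
  Kbar0 ω₀ T ε u / Gamma0 ω₀ T ε + Kbar1 ω₀ εF T ε u / Gamma0 ω₀ T ε
    - Kbar2 ω₀ T ε u / Gamma0 ω₀ T ε

/-- The measure `dσ(ε) = w(ε) Γ₀(ε) dε`; the Hilbert space `L²_σ` is `L²` of this measure. -/
def sigma (ω₀ T : ℝ) : Measure ℝ :=
  volume.withDensity fun ε => ENNReal.ofReal (weight T ε * Gamma0 ω₀ T ε)

/-- `φ` is a solution in `L²_σ`, at temperature `T`, of the integral equation
`φ(ε) = 1/Γ₀(ε) + ∫ K(ε,u) φ(u) du`. -/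
structure IsSolution (ω₀ εF T : ℝ) (φ : ℝ → ℝ) : Prop where
  memLp : MemLp φ 2 (sigma ω₀ T)
  integrable : ∀ᵐ ε, Integrable fun u => K ω₀ εF T ε u * φ u
  equation : ∀ᵐ ε, φ ε = 1 / Gamma0 ω₀ T ε + ∫ u, K ω₀ εF T ε u * φ u

/-- The even part `φ₊`. -/
def evenPart (φ : ℝ → ℝ) (ε : ℝ) : ℝ := (φ ε + φ (-ε)) / 2

/-- The odd part `φ₋`. -/
def oddPart (φ : ℝ → ℝ) (ε : ℝ) : ℝ := (φ ε - φ (-ε)) / 2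

/-- For `T → 0⁺` the leading contribution to the family `f` (of functions of the energy, indexed
by the temperature) is `T ^ n Φ(ε/T)`, with `Φ` not the null function: the norm in `L²_σ` of
the difference is small compared with that of the leading contribution. In particular
the leading contribution scales as `T ^ n`. -/
structure HasLeadingTerm (ω₀ : ℝ) (f : ℝ → ℝ → ℝ) (n : ℝ) (Φ : ℝ → ℝ) : Prop where
  memLp : ∀ T : ℝ, 0 < T → MemLp (fun ε => T ^ n * Φ (ε / T)) 2 (sigma ω₀ T)
  not_null : ¬ Φ =ᵐ[volume] 0
  tendsto : Tendsto
    (fun T : ℝ => eLpNorm (fun ε => f T ε - T ^ n * Φ (ε / T)) 2 (sigma ω₀ T) /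
      eLpNorm (fun ε => T ^ n * Φ (ε / T)) 2 (sigma ω₀ T))
    (𝓝[>] 0) (𝓝 0)

end ElectronPhonon

end

/-! Put `ε = T x` and multiply functions by `conj = sqrtWeight * √rate`. Up to a scalar factor this
maps `L²_σ` isometrically onto the fixed space `L²(ℝ)`. Since `n(y-x) + f(y)` is a ratio of
square-root weights divided by `2 sinh ((y-x)/2)` (`bose_add_fermi`), equation (1) becomes `(A - TαB
+ T²βD) u = (ω₀²/T³) b₀` (`isSolution_iff`), with `α = 1/(2εF)` and `β = 1/(2ω₀²)`. Here `A = 1 -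
S₀`, `B = S₁`, `D = S₂`, and `S_j` has the kernel `(y-x)^j convKernel (y-x) / (√rate x √rate y)`:
symmetric for even `j`, skew for odd `j`.

The operator `A` annihilates the image `e` of the constants and has a spectral gap above it
(`exists_spectral_gap`). After multiplication by `T⁵` the right side is `T² b`, and one expands `u =
c e + T χ + T² ξ + …`. Order `T` reads `Aχ = cα Be`, solvable because `B` is skew. Order `T²` is
solvable exactly when `c (α²⟪Be, χ₁⟫ + β⟪De, e⟫) = ⟪e, b⟫`, where `Aχ₁ = Be`; both terms in the
bracket are nonnegative and the second is positive, so `c > 0`. Reflection commutes with `A` and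
anticommutes with `B`, so `χ` can be taken odd, and `Be ≠ 0` gives `χ ≠ 0`. The remainder is
controlled by coercivity of order one across `e` and of order `T²` along `e`
(`exists_leading_order`).

The gap combines a Poincaré inequality on a bounded interval with the growth of `rate` at infinity,
which makes `S₀` a small form there. Uniqueness of limits then forces the exponents and the
constancy of `Φ₊`. -/

/-! ### Singular perturbation of a symmetric operator with a spectral gap -/

section AbstractPerturbation

open RealInnerProductSpace

variable {H : Type*} [NormedAddCommGroup H] [InnerProductSpace ℝ H]

/-- If `A` has the spectral gap `κ` above the null vector `e`, and `D` is positive on `e`, then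
`A + s D` is coercive for small `s > 0`, with constant of order `s` along `e` and of order one
in the other directions. -/
theorem exists_coercive_of_gap (A D : H →L[ℝ] H) (e : H) {κ : ℝ} (hκ : 0 < κ)
    (hA : ∀ u, ∃ m : ℝ, κ * ‖u - m • e‖ ^ 2 ≤ ⟪A u, u⟫) (hD : 0 < ⟪D e, e⟫) :
    ∃ s₀ > 0, ∃ k > 0, ∀ s, 0 < s → s < s₀ → ∀ u, ∃ m : ℝ,
      k * (‖u - m • e‖ ^ 2 + s * m ^ 2) ≤ ⟪A u, u⟫ + s * ⟪D u, u⟫ := by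
  set d := ⟪D e, e⟫ with hd
  set N := ‖D‖ with hN
  have hN0 : 0 ≤ N := norm_nonneg _
  set M := N * ‖e‖ with hM
  have hM0 : 0 ≤ M := by positivity
  -- Young's inequality absorbs the cross terms of `D` between `e` and `v`, at the cost of half of
  -- `⟪D e, e⟫`.
  have key : ∀ (m : ℝ) (v : H),
      d / 2 * m ^ 2 - (2 * M ^ 2 / d + N) * ‖v‖ ^ 2 ≤ ⟪D (m • e + v), m • e + v⟫ := by
    intro m v
    have h1 : ⟪D (m • e + v), m • e + v⟫
        = m ^ 2 * d + m * (⟪D e, v⟫ + ⟪D v, e⟫) + ⟪D v, v⟫ := by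
      simp only [map_add, map_smul, inner_add_left, inner_add_right, inner_smul_left,
        inner_smul_right, hd, RCLike.conj_to_real]
      ring
    have h2 : |⟪D e, v⟫| ≤ M * ‖v‖ := (abs_real_inner_le_norm _ _).trans
      (mul_le_mul_of_nonneg_right (D.le_opNorm e) (norm_nonneg v))
    have h3 : |⟪D v, e⟫| ≤ M * ‖v‖ := by
      refine (abs_real_inner_le_norm _ _).trans
        ((mul_le_mul_of_nonneg_right (D.le_opNorm v) (norm_nonneg e)).trans_eq ?_)
      rw [hM]; ring
    have h4 : |⟪D v, v⟫| ≤ N * ‖v‖ ^ 2 := by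
      refine (abs_real_inner_le_norm _ _).trans
        ((mul_le_mul_of_nonneg_right (D.le_opNorm v) (norm_nonneg v)).trans_eq ?_)
      ring
    have h5 : |m * (⟪D e, v⟫ + ⟪D v, e⟫)| ≤ |m| * (2 * M * ‖v‖) := by
      rw [abs_mul]
      refine mul_le_mul_of_nonneg_left ((abs_add_le _ _).trans ?_) (abs_nonneg m)
      linarith
    have h6 : |m| * (2 * M * ‖v‖) ≤ d / 2 * m ^ 2 + 2 * M ^ 2 / d * ‖v‖ ^ 2 := by
      have : 0 ≤ (d * |m| - 2 * M * ‖v‖) ^ 2 / (2 * d) := by positivity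
      have h7 : (d * |m| - 2 * M * ‖v‖) ^ 2 / (2 * d)
          = d / 2 * |m| ^ 2 + 2 * M ^ 2 / d * ‖v‖ ^ 2 - |m| * (2 * M * ‖v‖) := by
        field_simp; ring
      rw [h7, sq_abs] at this
      linarith
    rw [h1]
    have := neg_abs_le (m * (⟪D e, v⟫ + ⟪D v, e⟫))
    have := neg_abs_le ⟪D v, v⟫
    nlinarith
  set L := 2 * M ^ 2 / d + N with hL
  have hL0 : 0 ≤ L := by positivity
  -- This bound on `s` keeps the loss `s L ‖v‖²` below half of the gap.
  refine ⟨κ / (2 * (L + 1)), by positivity, min (κ / 2) (d / 2), by positivity, ?_⟩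
  intro s hs hs1 u
  obtain ⟨m, hm⟩ := hA u
  refine ⟨m, ?_⟩
  have h1 := key m (u - m • e)
  rw [add_sub_cancel] at h1
  have h2 : s * L ≤ κ / 2 := by
    rw [lt_div_iff₀ (by positivity)] at hs1
    nlinarith
  have h3 : min (κ / 2) (d / 2) * ‖u - m • e‖ ^ 2 ≤ κ / 2 * ‖u - m • e‖ ^ 2 :=
    mul_le_mul_of_nonneg_right (min_le_left _ _) (by positivity)
  have h4 : min (κ / 2) (d / 2) * (s * m ^ 2) ≤ d / 2 * (s * m ^ 2) :=
    mul_le_mul_of_nonneg_right (min_le_right _ _) (by positivity)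
  have h5 := mul_le_mul_of_nonneg_left h1 hs.le
  have h6 := mul_le_mul_of_nonneg_right h2 (sq_nonneg ‖u - m • e‖)
  nlinarith

/-- Turns the anisotropic lower bound into ordinary coercivity, with a constant that degenerates
with `s`: enough for invertibility, too weak for the asymptotics. -/
theorem norm_sq_le_of_decomposition (e u : H) {s m : ℝ} (hs : 0 < s) :
    s / (s + ‖e‖ ^ 2 + 1) / 2 * ‖u‖ ^ 2 ≤ ‖u - m • e‖ ^ 2 + s * m ^ 2 := by
  have h0 : ‖u‖ ≤ ‖u - m • e‖ + |m| * ‖e‖ := by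
    calc ‖u‖ = ‖(u - m • e) + m • e‖ := by rw [sub_add_cancel]
      _ ≤ _ := by
        refine (norm_add_le _ _).trans_eq ?_
        rw [norm_smul, Real.norm_eq_abs]
  have h1 : ‖u‖ ^ 2 ≤ 2 * ‖u - m • e‖ ^ 2 + 2 * (m ^ 2 * ‖e‖ ^ 2) := by
    have h2 : ‖u‖ ^ 2 ≤ (‖u - m • e‖ + |m| * ‖e‖) ^ 2 :=
      pow_le_pow_left₀ (norm_nonneg _) h0 2
    have h3 : (|m| * ‖e‖) ^ 2 = m ^ 2 * ‖e‖ ^ 2 := by rw [mul_pow, sq_abs]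
    nlinarith [sq_nonneg (‖u - m • e‖ - |m| * ‖e‖)]
  have hp : 0 < s + ‖e‖ ^ 2 + 1 := by positivity
  rw [div_div, div_mul_eq_mul_div, div_le_iff₀ (by positivity)]
  have h4 : 0 ≤ ‖u - m • e‖ ^ 2 := by positivity
  have h5 : 0 ≤ m ^ 2 := by positivity
  have h6 : 0 ≤ ‖e‖ ^ 2 := by positivity
  have h7 := mul_le_mul_of_nonneg_left h1 hs.le
  nlinarith [mul_nonneg h4 h6, mul_nonneg hs.le h5, mul_nonneg (mul_nonneg hs.le h5) hs.le]

variable [CompleteSpace H]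

/-- The Lax–Milgram theorem, stated for an operator instead of a bilinear form. -/
theorem ContinuousLinearMap.bijective_of_coercive (L : H →L[ℝ] H) {k : ℝ} (hk : 0 < k)
    (h : ∀ u, k * ‖u‖ ^ 2 ≤ ⟪L u, u⟫) : Function.Bijective L := by
  have hc : IsCoercive ((innerSL ℝ : H →L[ℝ] H →L[ℝ] ℝ) ∘L L) :=
    ⟨k, hk, fun u => by
      rw [mul_assoc, ← sq]
      exact h u⟩
  have : ∀ u, L u = hc.continuousLinearEquivOfBilin u := fun u =>
    hc.unique_continuousLinearEquivOfBilin (fun _ => rfl)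
  have h2 : (L : H → H) = hc.continuousLinearEquivOfBilin := funext this
  rw [h2]
  exact hc.continuousLinearEquivOfBilin.bijective

/-- A skew term `N` does not enter the quadratic form, so it needs no smallness and `s₀` does not
depend on it. -/
theorem exists_bijective_of_gap (A D : H →L[ℝ] H) (e : H) {κ : ℝ} (hκ : 0 < κ)
    (hA : ∀ u, ∃ m : ℝ, κ * ‖u - m • e‖ ^ 2 ≤ ⟪A u, u⟫) (hD : 0 < ⟪D e, e⟫) :
    ∃ s₀ > 0, ∀ s : ℝ, 0 < s → s < s₀ → ∀ N : H →L[ℝ] H, (∀ u, ⟪N u, u⟫ = 0) →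
      Function.Bijective (⇑(A + N + s • D) : H → H) := by
  obtain ⟨s₀, hs₀, k, hk, h⟩ := exists_coercive_of_gap A D e hκ hA hD
  refine ⟨s₀, hs₀, fun s hs hs1 N hN => ?_⟩
  refine ContinuousLinearMap.bijective_of_coercive _
    (k := k * (s / (s + ‖e‖ ^ 2 + 1) / 2)) (by positivity) fun u => ?_
  obtain ⟨m, hm⟩ := h s hs hs1 u
  have h1 := mul_le_mul_of_nonneg_left (norm_sq_le_of_decomposition e u (m := m) hs) hk.le
  simp only [_root_.add_apply, _root_.smul_apply, inner_add_left,
    inner_smul_left, hN, RCLike.conj_to_real]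
  linarith

/-- Fredholm alternative for a symmetric operator with a spectral gap. -/
theorem exists_solution_of_gap (A : H →L[ℝ] H) (e : H) {κ : ℝ} (hκ : 0 < κ)
    (hA : ∀ u, ∃ m : ℝ, κ * ‖u - m • e‖ ^ 2 ≤ ⟪A u, u⟫)
    (hsymm : ∀ u v, ⟪A u, v⟫ = ⟪u, A v⟫) (hAe : A e = 0) (he : e ≠ 0)
    (r : H) (hr : ⟪e, r⟫ = 0) : ∃ χ, A χ = r := by
  -- The rank-one perturbation `e ⊗ e` makes `A` invertible. Pairing the perturbed equation with `e`
  -- shows `⟪e, χ⟫ = 0`, so the perturbation vanishes on its solution.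
  set D : H →L[ℝ] H := (innerSL ℝ e).smulRight e with hD
  have hDu : ∀ u, D u = ⟪e, u⟫ • e := fun u => by simp [hD]
  have hpos : 0 < ⟪e, e⟫ := real_inner_self_pos.mpr he
  have hDe : 0 < ⟪D e, e⟫ := by
    rw [hDu, inner_smul_left]
    exact mul_pos hpos hpos
  obtain ⟨s₀, hs₀, h⟩ := exists_bijective_of_gap A D e hκ hA hDe
  obtain ⟨χ, hχ⟩ := (h (s₀ / 2) (by positivity) (by linarith) 0 (by simp)).2 r
  simp only [_root_.add_apply, _root_.smul_apply, hDu,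
    add_zero] at hχ
  have h1 : ⟪e, χ⟫ = 0 := by
    have h2 := congrArg (fun x => ⟪e, x⟫) hχ
    simp only [inner_add_right, inner_smul_right, hr, ← hsymm, hAe, inner_zero_left,
      zero_add] at h2
    have : s₀ / 2 ≠ 0 := by positivity
    simpa [this, he] using h2
  refine ⟨χ, ?_⟩
  simpa [h1] using hχ

/-- With `V = T X` the hypothesis becomes `X² + m² ≲ T (X + |m|)`, hence `X + |m| ≲ T`. The
component across `e` thus gains one more power of `T` than the one along `e`. -/
theorem le_of_quadratic_le {k β R E T V m : ℝ} (hk : 0 < k) (hβ : 0 < β) (hR : 0 ≤ R)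
    (hE : 0 ≤ E) (hT : 0 < T) (hT1 : T < 1) (hV : 0 ≤ V)
    (h : k * (V ^ 2 + T ^ 2 * β * m ^ 2) ≤ T ^ 3 * (R * (V + |m| * E))) :
    V ≤ 2 * (R * (E + 1)) / (k * min 1 β) * T ^ 2 ∧
      |m| ≤ 2 * (R * (E + 1)) / (k * min 1 β) * T := by
  set K : ℝ := k * min 1 β with hK
  have hK0 : 0 < K := by positivity
  set C : ℝ := 2 * (R * (E + 1)) / K with hC
  have hC0 : 0 ≤ C := by positivity
  obtain ⟨X, hX0, rfl⟩ : ∃ X, 0 ≤ X ∧ V = T * X := ⟨V / T, by positivity, by field_simp⟩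
  have hm0 := abs_nonneg m
  rw [← sq_abs m] at h
  set Y := |m| with hY
  have h1 : K * (X ^ 2 + Y ^ 2) ≤ R * (E + 1) * T * (X + Y) := by
    have h2 : T ^ 2 * (K * (X ^ 2 + Y ^ 2)) ≤ k * ((T * X) ^ 2 + T ^ 2 * β * Y ^ 2) := by
      have h3 : min 1 β * X ^ 2 ≤ 1 * X ^ 2 :=
        mul_le_mul_of_nonneg_right (min_le_left _ _) (by positivity)
      have h4 : min 1 β * Y ^ 2 ≤ β * Y ^ 2 :=
        mul_le_mul_of_nonneg_right (min_le_right _ _) (by positivity)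
      calc T ^ 2 * (k * min 1 β * (X ^ 2 + Y ^ 2))
          = T ^ 2 * k * (min 1 β * X ^ 2 + min 1 β * Y ^ 2) := by ring
        _ ≤ T ^ 2 * k * (1 * X ^ 2 + β * Y ^ 2) :=
          mul_le_mul_of_nonneg_left (by linarith) (by positivity)
        _ = _ := by ring
    have h5 : T ^ 3 * (R * (T * X + Y * E)) ≤ T ^ 2 * (R * (E + 1) * T * (X + Y)) := by
      have h6 : T * X + Y * E ≤ (E + 1) * (X + Y) := by
        have h7 : T * X ≤ X := mul_le_of_le_one_left hX0 hT1.le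
        have h8 : 0 ≤ E * X := by positivity
        linarith
      calc T ^ 3 * (R * (T * X + Y * E))
          ≤ T ^ 3 * (R * ((E + 1) * (X + Y))) := by gcongr
        _ = _ := by ring
    exact le_of_mul_le_mul_left ((h2.trans h).trans h5) (by positivity)
  have hXY : X + Y ≤ C * T := by
    rcases (add_nonneg hX0 hm0).eq_or_lt with h0 | h0
    · rw [← h0]; positivity
    rw [hC, div_mul_eq_mul_div, le_div_iff₀ hK0]
    have h2 : (X + Y) ^ 2 ≤ 2 * (X ^ 2 + Y ^ 2) := by linarith [sq_nonneg (X - Y)]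
    refine le_of_mul_le_mul_right ?_ h0
    calc (X + Y) * K * (X + Y) = K * (X + Y) ^ 2 := by ring
      _ ≤ K * (2 * (X ^ 2 + Y ^ 2)) := by gcongr
      _ ≤ 2 * (R * (E + 1) * T * (X + Y)) := by linarith
      _ = _ := by ring
  refine ⟨?_, by linarith⟩
  calc T * X ≤ T * (C * T) := by gcongr; linarith
    _ = C * T ^ 2 := by ring

/-- Singular perturbation theory: the leading order of the solution of
`(A - T α B + T² β D) u = T² b`, for a symmetric `A` with a spectral gap above the null vector `e`
and a skew-symmetric `B`, along `e` and in the subspace that is odd under the reflection `J`. -/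
theorem exists_leading_order (A B D J : H →L[ℝ] H) (e b : H) {κ α β : ℝ} (hκ : 0 < κ)
    (hα : 0 < α) (hβ : 0 < β)
    (hA : ∀ u, ∃ m : ℝ, κ * ‖u - m • e‖ ^ 2 ≤ ⟪A u, u⟫)
    (hsymm : ∀ u v, ⟪A u, v⟫ = ⟪u, A v⟫) (hAe : A e = 0)
    (hB : ∀ u v, ⟪B u, v⟫ = -⟪u, B v⟫) (hBe : B e ≠ 0) (hD : 0 < ⟪D e, e⟫) (hb : 0 < ⟪e, b⟫)
    (hJ : ∀ u, ‖J u‖ ≤ ‖u‖) (hJe : J e = e) (hJJ : ∀ u, J (J u) = u)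
    (hJA : ∀ u, J (A u) = A (J u)) (hJB : ∀ u, J (B u) = -B (J u)) :
    ∃ (c : ℝ) (χ : H) (C T₀ : ℝ), 0 < c ∧ χ ≠ 0 ∧ J χ = -χ ∧ 0 < T₀ ∧
      ∀ T, 0 < T → T < T₀ → ∀ u, A u - (T * α) • B u + (T ^ 2 * β) • D u = T ^ 2 • b →
        ‖u - c • e‖ ≤ C * T ∧ ‖(1 / 2 : ℝ) • (u - J u) - T • χ‖ ≤ C * T ^ 2 := by
  have he : e ≠ 0 := by
    rintro rfl
    simp at hD
  have hBself : ∀ u, ⟪u, B u⟫ = 0 := fun u => by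
    have := hB u u
    rw [real_inner_comm] at this
    linarith
  obtain ⟨χ₀, hχ₀⟩ := exists_solution_of_gap A e hκ hA hsymm hAe he (B e) (hBself e)
  -- the odd solution
  set χ₁ : H := (1 / 2 : ℝ) • (χ₀ - J χ₀) with hχ₁
  have hAχ₁ : A χ₁ = B e := by
    have h1 : A (J χ₀) = -B e := by rw [← hJA, hχ₀, hJB, hJe]
    rw [hχ₁, map_smul, map_sub, hχ₀, h1, sub_neg_eq_add, ← two_smul ℝ, smul_smul]
    norm_num
  have hJχ₁ : J χ₁ = -χ₁ := by
    rw [hχ₁, map_smul, map_sub, hJJ, ← smul_neg, neg_sub]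
  -- This is the form of `A` at `χ₁`, because `A χ₁ = B e`.
  have hnn : 0 ≤ ⟪B e, χ₁⟫ := by
    obtain ⟨m, hm⟩ := hA χ₁
    rw [hAχ₁] at hm
    exact le_trans (by positivity) hm
  have hden : 0 < α ^ 2 * ⟪B e, χ₁⟫ + β * ⟪D e, e⟫ := by positivity
  -- The value for which the second-order right side is orthogonal to `e`, as the equation for `ξ`
  -- requires.
  set c : ℝ := ⟪e, b⟫ / (α ^ 2 * ⟪B e, χ₁⟫ + β * ⟪D e, e⟫) with hc
  have hc0 : 0 < c := by positivity
  set χ : H := (c * α) • χ₁ with hχ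
  have hAχ : A χ = (c * α) • B e := by rw [hχ, map_smul, hAχ₁]
  obtain ⟨ξ, hξ⟩ := exists_solution_of_gap A e hκ hA hsymm hAe he
    (b + α • B χ - (β * c) • D e) (by
      have h1 : ⟪e, B χ₁⟫ = -⟪B e, χ₁⟫ := by rw [hB e χ₁, neg_neg]
      have h2 : ⟪e, b⟫ = c * (α ^ 2 * ⟪B e, χ₁⟫ + β * ⟪D e, e⟫) := by
        rw [hc]; field_simp
      rw [inner_sub_right, inner_add_right, hχ, map_smul, inner_smul_right, inner_smul_right,
        inner_smul_right, h1, h2, real_inner_comm (D e) e]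
      ring)
  have hJχ : J χ = -χ := by rw [hχ, map_smul, hJχ₁, smul_neg]
  have hχ0 : χ ≠ 0 := by
    rw [hχ]
    refine smul_ne_zero (by positivity) fun h => hBe ?_
    rw [← hAχ₁, h, map_zero]
  clear_value χ
  obtain ⟨s₀, hs₀, k, hk, hco⟩ := exists_coercive_of_gap A D e hκ hA hD
  set R : ℝ := α * ‖B ξ‖ + β * ‖D χ‖ + β * ‖D ξ‖ with hR
  have hR0 : 0 ≤ R := by positivity
  set C₁ : ℝ := 2 * (R * (‖e‖ + 1)) / (k * min 1 β) with hC₁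
  have hC₁0 : 0 ≤ C₁ := by positivity
  refine ⟨c, χ, C₁ * (‖e‖ + 1) + ‖χ‖ + ‖ξ‖, min 1 (Real.sqrt (s₀ / β)), hc0, hχ0, hJχ,
    by positivity, ?_⟩
  intro T hT hTT u hu
  have hT1 : T < 1 := hTT.trans_le (min_le_left _ _)
  have hTs : T ^ 2 * β < s₀ := by
    have := (Real.lt_sqrt hT.le).mp (hTT.trans_le (min_le_right _ _))
    rwa [lt_div_iff₀ hβ] at this
  -- The remainder solves the same equation with a source of order `T³`, all lower orders having
  -- been cancelled by the choice of `c`, `χ` and `ξ`.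
  set w : H := u - c • e - T • χ - T ^ 2 • ξ with hw
  have hres : A w - (T * α) • B w + (T ^ 2 * β) • D w
      = T ^ 3 • (α • B ξ - β • D χ - (T * β) • D ξ) := by
    have h1 : A w - (T * α) • B w + (T ^ 2 * β) • D w
        = (A u - (T * α) • B u + (T ^ 2 * β) • D u)
          - (c • A e - (T * α) • c • B e + (T ^ 2 * β) • c • D e)
          - T • (A χ - (T * α) • B χ + (T ^ 2 * β) • D χ)
          - T ^ 2 • (A ξ - (T * α) • B ξ + (T ^ 2 * β) • D ξ) := by
      simp only [hw, map_sub, map_smul]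
      module
    rw [h1, hu, hAe, hAχ, hξ]
    module
  obtain ⟨m, hm⟩ := hco (T ^ 2 * β) (by positivity) hTs w
  set v : H := w - m • e with hv
  have hwv : w = v + m • e := by rw [hv, sub_add_cancel]
  have hin : ⟪A w, w⟫ + T ^ 2 * β * ⟪D w, w⟫
      = ⟪T ^ 3 • (α • B ξ - β • D χ - (T * β) • D ξ), w⟫ := by
    rw [← hres, inner_add_left, inner_sub_left, inner_smul_left, inner_smul_left,
      RCLike.conj_to_real, RCLike.conj_to_real, real_inner_comm w (B w), hBself]
    ring
  have hnorm : ‖α • B ξ - β • D χ - (T * β) • D ξ‖ ≤ R := by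
    refine (norm_sub_le _ _).trans ?_
    refine (add_le_add_left (norm_sub_le _ _) _).trans ?_
    rw [norm_smul, norm_smul, norm_smul, Real.norm_of_nonneg hα.le, Real.norm_of_nonneg hβ.le,
      Real.norm_of_nonneg (by positivity : 0 ≤ T * β), hR]
    have : T * β * ‖D ξ‖ ≤ β * ‖D ξ‖ := by
      rw [mul_assoc]
      exact mul_le_of_le_one_left (by positivity) hT1.le
    linarith
  have hup : ⟪T ^ 3 • (α • B ξ - β • D χ - (T * β) • D ξ), w⟫
      ≤ T ^ 3 * (R * (‖v‖ + |m| * ‖e‖)) := by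
    rw [inner_smul_left, RCLike.conj_to_real]
    refine mul_le_mul_of_nonneg_left ?_ (by positivity)
    refine (real_inner_le_norm _ _).trans (mul_le_mul hnorm ?_ (norm_nonneg _) hR0)
    rw [hwv]
    refine (norm_add_le _ _).trans_eq ?_
    rw [norm_smul, Real.norm_eq_abs]
  rw [hin] at hm
  have hm2 := hm.trans hup
  obtain ⟨hvT, hmT⟩ := le_of_quadratic_le hk hβ hR0 (norm_nonneg e) hT hT1 (norm_nonneg v) hm2
  rw [← hC₁] at hvT hmT
  clear_value C₁
  have hTT2 : T ^ 2 ≤ T := by nlinarith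
  have hsplit : u - c • e = v + m • e + T • χ + T ^ 2 • ξ := by
    rw [← hwv, hw]; module
  constructor
  · rw [hsplit]
    refine (norm_add_le _ _).trans ((add_le_add_left ((norm_add_le _ _).trans
      (add_le_add_left (norm_add_le _ _) _)) _).trans ?_)
    rw [norm_smul, norm_smul, norm_smul, Real.norm_eq_abs, Real.norm_of_nonneg hT.le,
      Real.norm_of_nonneg (by positivity : 0 ≤ T ^ 2)]
    have h1 : |m| * ‖e‖ ≤ C₁ * T * ‖e‖ := by gcongr
    have h2 : T ^ 2 * ‖ξ‖ ≤ T * ‖ξ‖ := by gcongr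
    have h3 : C₁ * T ^ 2 ≤ C₁ * T := by gcongr
    linarith
  -- The error `m • e` is only of order `T`, but it is even and drops out; what is left is of order
  -- `T²`.
  · have hodd : (1 / 2 : ℝ) • (u - J u) - T • χ
        = (1 / 2 : ℝ) • (v - J v) + T ^ 2 • (1 / 2 : ℝ) • (ξ - J ξ) := by
      have h1 : u = c • e + (v + m • e + T • χ + T ^ 2 • ξ) := by rw [← hsplit]; module
      rw [h1]
      simp only [map_add, map_smul, hJe, hJχ]
      module
    have hhalf : ∀ x : H, ‖(1 / 2 : ℝ) • (x - J x)‖ ≤ ‖x‖ := fun x => by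
      rw [norm_smul]
      have := norm_sub_le x (J x)
      have := hJ x
      norm_num
      linarith
    rw [hodd]
    refine (norm_add_le _ _).trans ((add_le_add (hhalf v)
      (?_ : _ ≤ T ^ 2 * ‖ξ‖)).trans ?_)
    · rw [norm_smul, Real.norm_of_nonneg (by positivity : 0 ≤ T ^ 2)]
      exact mul_le_mul_of_nonneg_left (hhalf ξ) (by positivity)
    · have h1 : 0 ≤ C₁ * ‖e‖ * T ^ 2 := by positivity
      have h2 : 0 ≤ ‖χ‖ * T ^ 2 := by positivity
      linarith

end AbstractPerturbation

/-! ### Integral operators dominated by a convolution, and the reflection -/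

section SchurOperators

open RealInnerProductSpace

/-- This is the integrand of the convolution of `f` with the reflected `κ`. -/
theorem integrable_kernel_mul_snd {κ f : ℝ → ℝ} (hκ : Integrable κ) (hf : Integrable f) :
    Integrable (fun p : ℝ × ℝ => κ (p.2 - p.1) * f p.2) (volume.prod volume) := by
  have h := hf.convolution_integrand (ContinuousLinearMap.mul ℝ ℝ) hκ.comp_neg (μ := volume)
  refine h.congr (Eventually.of_forall fun p => ?_)
  simp [mul_comm]

theorem integrable_kernel_mul_fst {κ f : ℝ → ℝ} (hκ : Integrable κ) (hf : Integrable f) :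
    Integrable (fun p : ℝ × ℝ => κ (p.2 - p.1) * f p.1) (volume.prod volume) := by
  have h := (integrable_kernel_mul_snd hκ.comp_neg hf).swap
  refine h.congr (Eventually.of_forall fun p => ?_)
  simp

/-- `s` is a measurable kernel dominated by the convolution kernel of the integrable
function `κ`. -/
structure ConvDominated (κ : ℝ → ℝ) (s : ℝ → ℝ → ℝ) : Prop where
  integrable : Integrable κ
  measurable : Measurable (Function.uncurry s)
  bound : ∀ x y, |s x y| ≤ κ (y - x)

theorem integrable_translate {κ : ℝ → ℝ} (hκ : Integrable κ) (x : ℝ) :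
    Integrable fun y => κ (y - x) := hκ.comp_sub_right x

theorem integral_translate (κ : ℝ → ℝ) (x : ℝ) : ∫ y, κ (y - x) = ∫ z, κ z :=
  integral_sub_right_eq_self κ x

namespace ConvDominated

variable {κ : ℝ → ℝ} {s : ℝ → ℝ → ℝ}

theorem nonneg (hs : ConvDominated κ s) (z : ℝ) : 0 ≤ κ z := by
  simpa using (abs_nonneg _).trans (hs.bound 0 z)

theorem aestronglyMeasurable_prod (hs : ConvDominated κ s) {u v : ℝ → ℝ}
    (hu : AEStronglyMeasurable u volume) (hv : AEStronglyMeasurable v volume) :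
    AEStronglyMeasurable (fun p : ℝ × ℝ => s p.1 p.2 * u p.2 * v p.1)
      (volume.prod volume) :=
  (hs.measurable.aestronglyMeasurable.mul hu.comp_snd).mul hv.comp_fst

theorem integrable_prod (hs : ConvDominated κ s) {u v : ℝ → ℝ}
    (hu : MemLp u 2 volume) (hv : MemLp v 2 volume) :
    Integrable (fun p : ℝ × ℝ => s p.1 p.2 * u p.2 * v p.1) (volume.prod volume) := by
  have h1 := integrable_kernel_mul_snd hs.integrable hu.integrable_sq
  have h2 := integrable_kernel_mul_fst hs.integrable hv.integrable_sq
  refine (h1.add h2).mono' (hs.aestronglyMeasurable_prod hu.1 hv.1)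
    (Eventually.of_forall fun p => ?_)
  rw [Real.norm_eq_abs, abs_mul, abs_mul, Pi.add_apply, ← sq_abs (u p.2), ← sq_abs (v p.1),
    mul_assoc, ← mul_add]
  refine mul_le_mul (hs.bound _ _) ?_ (by positivity) (hs.nonneg _)
  nlinarith [sq_nonneg (|u p.2| - |v p.1|), sq_nonneg (|u p.2| + |v p.1|)]

/-- Cauchy–Schwarz with respect to the measure `κ (y - x) dy`, whose mass does not depend on `x`. -/
theorem ae_integrable_and_sq_le (hs : ConvDominated κ s) {u : ℝ → ℝ} (hu : MemLp u 2 volume) :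
    ∀ᵐ x, Integrable (fun y => s x y * u y) ∧
      (∫ y, s x y * u y) ^ 2 ≤ (∫ z, κ z) * ∫ y, κ (y - x) * u y ^ 2 := by
  have h1 := (integrable_kernel_mul_snd hs.integrable hu.integrable_sq).prod_right_ae
  filter_upwards [h1] with x hx
  have hx1 := integrable_translate hs.integrable x
  have hκu : Integrable fun y => κ (y - x) * |u y| := by
    refine (hx1.add hx).mono' (hx1.1.mul hu.1.norm) (Eventually.of_forall fun y => ?_)
    have := hs.nonneg (y - x)
    rw [Real.norm_eq_abs, abs_mul, abs_abs, abs_of_nonneg this, Pi.add_apply, ← sq_abs (u y)]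
    nlinarith [sq_nonneg (|u y| - 1), abs_nonneg (u y)]
  have hle : ∀ y, |s x y * u y| ≤ κ (y - x) * |u y| := fun y => by
    rw [abs_mul]
    exact mul_le_mul_of_nonneg_right (hs.bound x y) (abs_nonneg _)
  have hint : Integrable fun y => s x y * u y :=
    hκu.mono' ((hs.measurable.comp measurable_prodMk_left).aestronglyMeasurable.mul hu.1)
      (Eventually.of_forall hle)
  refine ⟨hint, ?_⟩
  have habs : |∫ y, s x y * u y| ≤ ∫ y, κ (y - x) * |u y| :=
    (abs_integral_le_integral_abs).trans (integral_mono hint.abs hκu hle)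
  -- Cauchy–Schwarz in discriminant form: the quadratic `t ↦ ∫ κ (y - x) (t - |u y|)²` is
  -- nonnegative.
  have hdisc : discrim (∫ z, κ z) (-2 * ∫ y, κ (y - x) * |u y|)
      (∫ y, κ (y - x) * u y ^ 2) ≤ 0 := by
    refine discrim_le_zero fun t => ?_
    have h3 : 0 ≤ ∫ y, κ (y - x) * (t - |u y|) ^ 2 :=
      integral_nonneg fun y => mul_nonneg (hs.nonneg _) (sq_nonneg _)
    have h4 : ∀ y, κ (y - x) * (t - |u y|) ^ 2
        = t ^ 2 * κ (y - x) - 2 * t * (κ (y - x) * |u y|) + κ (y - x) * u y ^ 2 := fun y => by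
      rw [← sq_abs (u y)]; ring
    simp_rw [h4] at h3
    have h5 : Integrable fun y => t ^ 2 * κ (y - x) - 2 * t * (κ (y - x) * |u y|) :=
      (hx1.const_mul _).sub (hκu.const_mul _)
    rw [integral_add h5 hx, integral_sub (hx1.const_mul _) (hκu.const_mul _), integral_const_mul, integral_const_mul,
      integral_translate] at h3
    linarith
  rw [discrim] at hdisc
  have h5 : (∫ y, s x y * u y) ^ 2 ≤ (∫ y, κ (y - x) * |u y|) ^ 2 := by
    rw [← sq_abs]
    exact pow_le_pow_left₀ (abs_nonneg _) habs 2
  nlinarith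

theorem aestronglyMeasurable_integral (hs : ConvDominated κ s) {u : ℝ → ℝ}
    (hu : AEStronglyMeasurable u volume) :
    AEStronglyMeasurable (fun x => ∫ y, s x y * u y) volume :=
  (hs.measurable.aestronglyMeasurable.mul hu.comp_snd).integral_prod_right'
    (μ := volume) (ν := volume) (f := fun p : ℝ × ℝ => s p.1 p.2 * u p.2)

theorem integrable_sq_integral (hs : ConvDominated κ s) {u : ℝ → ℝ} (hu : MemLp u 2 volume) :
    Integrable fun x => (∫ y, s x y * u y) ^ 2 := by
  have h1 := (integrable_kernel_mul_snd hs.integrable hu.integrable_sq).integral_prod_left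
  refine (h1.const_mul (∫ z, κ z)).mono' ((hs.aestronglyMeasurable_integral hu.1).pow 2) ?_
  filter_upwards [hs.ae_integrable_and_sq_le hu] with x hx
  rw [Real.norm_of_nonneg (sq_nonneg _)]
  exact hx.2

theorem memLp_integral (hs : ConvDominated κ s) {u : ℝ → ℝ} (hu : MemLp u 2 volume) :
    MemLp (fun x => ∫ y, s x y * u y) 2 volume :=
  (memLp_two_iff_integrable_sq (hs.aestronglyMeasurable_integral hu.1)).mpr
    (hs.integrable_sq_integral hu)

/-- The Schur test: integrate the pointwise bound in `x` and exchange the integrals, which yields a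
second factor `∫ κ`. -/
theorem integral_sq_le (hs : ConvDominated κ s) {u : ℝ → ℝ} (hu : MemLp u 2 volume) :
    ∫ x, (∫ y, s x y * u y) ^ 2 ≤ (∫ z, κ z) ^ 2 * ∫ y, u y ^ 2 := by
  have h0 := integrable_kernel_mul_snd hs.integrable hu.integrable_sq
  calc ∫ x, (∫ y, s x y * u y) ^ 2
      ≤ ∫ x, (∫ z, κ z) * ∫ y, κ (y - x) * u y ^ 2 := by
        refine integral_mono_ae (hs.integrable_sq_integral hu)
          (h0.integral_prod_left.const_mul _) ?_
        filter_upwards [hs.ae_integrable_and_sq_le hu] with x hx using hx.2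
    _ = (∫ z, κ z) * ∫ y, ∫ x, κ (y - x) * u y ^ 2 := by
        rw [integral_const_mul, integral_integral_swap h0]
    _ = _ := by
        simp_rw [integral_mul_const, integral_sub_left_eq_self κ, integral_const_mul]
        ring

theorem _root_.Lp_norm_sq_eq_integral (u : Lp ℝ 2 (volume : Measure ℝ)) :
    ‖u‖ ^ 2 = ∫ x, u x ^ 2 := by
  rw [← real_inner_self_eq_norm_sq, L2.inner_def]
  simp [sq]

/-- The bounded operator on `L²(ℝ)` with the kernel `s`. -/
noncomputable def op (hs : ConvDominated κ s) :
    Lp ℝ 2 (volume : Measure ℝ) →L[ℝ] Lp ℝ 2 (volume : Measure ℝ) :=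
  LinearMap.mkContinuous
    { toFun := fun u => (hs.memLp_integral (Lp.memLp u)).toLp _
      map_add' := fun u v => by
        rw [← MemLp.toLp_add, MemLp.toLp_eq_toLp_iff]
        filter_upwards [hs.ae_integrable_and_sq_le (Lp.memLp u),
          hs.ae_integrable_and_sq_le (Lp.memLp v)] with x hu hv
        rw [Pi.add_apply, ← integral_add hu.1 hv.1]
        refine integral_congr_ae ?_
        filter_upwards [Lp.coeFn_add u v] with y hy
        rw [hy, Pi.add_apply, mul_add]
      map_smul' := fun c u => by
        rw [RingHom.id_apply, ← MemLp.toLp_const_smul, MemLp.toLp_eq_toLp_iff]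
        refine Eventually.of_forall fun x => ?_
        rw [Pi.smul_apply, smul_eq_mul, ← integral_const_mul]
        refine integral_congr_ae ?_
        filter_upwards [Lp.coeFn_smul c u] with y hy
        rw [hy, Pi.smul_apply, smul_eq_mul]
        ring }
    (∫ z, κ z) fun u => by
      refine le_of_sq_le_sq ?_ (mul_nonneg (integral_nonneg hs.nonneg) (norm_nonneg _))
      rw [mul_pow, Lp_norm_sq_eq_integral, Lp_norm_sq_eq_integral]
      refine le_trans (le_of_eq (integral_congr_ae ?_)) (hs.integral_sq_le (Lp.memLp u))
      filter_upwards [(hs.memLp_integral (Lp.memLp u)).coeFn_toLp] with x hx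
      simpa using congrArg (· ^ 2) hx

theorem coeFn_op (hs : ConvDominated κ s) (u : Lp ℝ 2 (volume : Measure ℝ)) :
    hs.op u =ᵐ[volume] fun x => ∫ y, s x y * u y :=
  (hs.memLp_integral (Lp.memLp u)).coeFn_toLp

theorem inner_op (hs : ConvDominated κ s) (u v : Lp ℝ 2 (volume : Measure ℝ)) :
    ⟪hs.op u, v⟫ = ∫ p, s p.1 p.2 * u p.2 * v p.1 ∂(volume.prod volume) := by
  rw [integral_prod _ (hs.integrable_prod (Lp.memLp u) (Lp.memLp v)), L2.inner_def]
  refine integral_congr_ae ?_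
  filter_upwards [hs.coeFn_op u] with x hx
  simp only [hx, integral_mul_const]
  simp [mul_comm]

theorem inner_op_comm (hs : ConvDominated κ s) {c : ℝ} (hc : ∀ x y, s x y = c * s y x)
    (u v : Lp ℝ 2 (volume : Measure ℝ)) : ⟪hs.op u, v⟫ = c * ⟪u, hs.op v⟫ := by
  rw [real_inner_comm (hs.op v) u, inner_op, inner_op, ← integral_const_mul,
    ← integral_prod_swap]
  refine integral_congr_ae (Eventually.of_forall fun p => ?_)
  simp only [Prod.fst_swap, Prod.snd_swap]
  rw [hc]; ring

end ConvDominated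

/-- The reflection `u ↦ u(-·)` of `L²(ℝ)`. -/
noncomputable def reflection :
    Lp ℝ 2 (volume : Measure ℝ) →L[ℝ] Lp ℝ 2 (volume : Measure ℝ) :=
  (Lp.compMeasurePreservingₗᵢ ℝ (fun x : ℝ => -x)
    (Measure.measurePreserving_neg volume)).toContinuousLinearMap

theorem coeFn_reflection (u : Lp ℝ 2 (volume : Measure ℝ)) :
    reflection u =ᵐ[volume] fun x => u (-x) :=
  Lp.coeFn_compMeasurePreserving u (Measure.measurePreserving_neg volume)

theorem norm_reflection (u : Lp ℝ 2 (volume : Measure ℝ)) : ‖reflection u‖ = ‖u‖ :=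
  LinearIsometry.norm_map _ u

theorem ae_neg {p : ℝ → Prop} (h : ∀ᵐ x, p x) : ∀ᵐ x, p (-x) :=
  (Measure.measurePreserving_neg (volume : Measure ℝ)).quasiMeasurePreserving.ae h

theorem reflection_reflection (u : Lp ℝ 2 (volume : Measure ℝ)) :
    reflection (reflection u) = u := by
  refine Lp.ext ?_
  filter_upwards [coeFn_reflection (reflection u), ae_neg (coeFn_reflection u)] with x h1 h2
  rw [h1, h2, neg_neg]

theorem ConvDominated.reflection_op {κ : ℝ → ℝ} {s : ℝ → ℝ → ℝ} (hs : ConvDominated κ s) {c : ℝ}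
    (hc : ∀ x y, s (-x) (-y) = c * s x y) (u : Lp ℝ 2 (volume : Measure ℝ)) :
    reflection (hs.op u) = c • hs.op (reflection u) := by
  refine Lp.ext ?_
  filter_upwards [coeFn_reflection (hs.op u), ae_neg (hs.coeFn_op u),
    hs.coeFn_op (reflection u), Lp.coeFn_smul c (hs.op (reflection u))] with x h1 h2 h3 h4
  rw [h1, h2, h4, Pi.smul_apply, h3, smul_eq_mul, ← integral_const_mul,
    ← integral_neg_eq_self]
  refine integral_congr_ae ?_
  filter_upwards [coeFn_reflection u] with y hy
  rw [hy, hc, mul_assoc]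

end SchurOperators

/-! ### The dimensionless kernel, weight and relaxation rate -/

noncomputable section

namespace ElectronPhonon

/-- The square root `1 / (2 cosh (x/2))` of the weight, as a function of `x = ε/T`. -/
def sqrtWeight (x : ℝ) : ℝ := 1 / (2 * Real.cosh (x / 2))

/-- The convolution kernel `z² / (2 |sinh (z/2)|)` to which the kernel `K̄₀` is conjugate. -/
def convKernel (z : ℝ) : ℝ := z ^ 2 / (2 * |Real.sinh (z / 2)|)

/-- The dimensionless relaxation rate. -/
def rate (x : ℝ) : ℝ := ∫ y, convKernel (y - x) * sqrtWeight y / sqrtWeight x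

theorem sqrtWeight_pos (x : ℝ) : 0 < sqrtWeight x := by
  have := Real.cosh_pos (x / 2)
  unfold sqrtWeight; positivity

theorem sqrtWeight_le (x : ℝ) : sqrtWeight x ≤ 1 := by
  have := Real.one_le_cosh (x / 2)
  unfold sqrtWeight
  rw [div_le_one (by positivity)]
  linarith

theorem sqrtWeight_neg (x : ℝ) : sqrtWeight (-x) = sqrtWeight x := by
  simp [sqrtWeight, neg_div]

theorem continuous_sqrtWeight : Continuous sqrtWeight := by
  unfold sqrtWeight
  refine continuous_const.div (by fun_prop) fun x => ?_
  have := Real.cosh_pos (x / 2)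
  positivity

theorem sqrtWeight_lt_iff {x y : ℝ} : sqrtWeight x < sqrtWeight y ↔ |y| < |x| := by
  have hx := Real.cosh_pos (x / 2)
  have hy := Real.cosh_pos (y / 2)
  unfold sqrtWeight
  rw [one_div_lt_one_div (by positivity) (by positivity), mul_lt_mul_iff_right₀ two_pos,
    Real.cosh_lt_cosh, abs_div, abs_div, div_lt_div_iff_of_pos_right (by positivity)]

theorem convKernel_nonneg (z : ℝ) : 0 ≤ convKernel z := by
  unfold convKernel; positivity

theorem convKernel_pos {z : ℝ} (hz : z ≠ 0) : 0 < convKernel z := by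
  have : Real.sinh (z / 2) ≠ 0 := by simpa using hz
  unfold convKernel; positivity

theorem convKernel_neg (z : ℝ) : convKernel (-z) = convKernel z := by
  simp [convKernel, neg_div]

theorem measurable_convKernel : Measurable convKernel := by
  have h : Measurable fun z : ℝ => Real.sinh (z / 2) :=
    (Real.continuous_sinh.comp (continuous_id.div_const 2)).measurable
  unfold convKernel
  exact (measurable_id.pow_const 2).div ((continuous_abs.measurable.comp h).const_mul 2)

theorem weight_eq (T ε : ℝ) : weight T ε = sqrtWeight (ε / T) ^ 2 := by
  unfold weight fermi sqrtWeight
  set x := ε / T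
  have h1 : Real.exp x = Real.exp (x / 2) ^ 2 := by rw [← Real.exp_nat_mul]; congr 1; ring
  rw [Real.cosh_eq, h1, Real.exp_neg]
  have := Real.exp_pos (x / 2)
  field_simp
  ring

/-- The identity behind the symmetrization: apart from a ratio of square-root weights, the thermal
factor depends only on `y - x`. -/
theorem bose_add_fermi {x y : ℝ} (h : y ≠ x) :
    bose (y - x) + fermi y
      = sqrtWeight y / sqrtWeight x / (2 * Real.sinh ((y - x) / 2)) := by
  unfold bose fermi sqrtWeight
  have ha := Real.exp_pos (x / 2)
  have hb := Real.exp_pos (y / 2)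
  have hy : Real.exp y = Real.exp (y / 2) ^ 2 := by rw [← Real.exp_nat_mul]; congr 1; ring
  have hx : Real.exp x = Real.exp (x / 2) ^ 2 := by rw [← Real.exp_nat_mul]; congr 1; ring
  have hz : (y - x) / 2 = y / 2 - x / 2 := by ring
  have hne : Real.exp (y / 2) ≠ Real.exp (x / 2) := fun h' =>
    h (by linarith [Real.exp_injective h'])
  rw [Real.sinh_eq, hz, neg_sub, Real.exp_sub, Real.exp_sub, Real.exp_sub, Real.cosh_eq,
    Real.cosh_eq, Real.exp_neg, Real.exp_neg, hx, hy]
  set a := Real.exp (x / 2)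
  set b := Real.exp (y / 2)
  have hne2 : b ^ 2 - a ^ 2 ≠ 0 := by
    rw [sq_sub_sq]
    exact mul_ne_zero (by positivity) (sub_ne_zero.mpr hne)
  have h1 : b ^ 2 / a ^ 2 - 1 ≠ 0 := by
    rw [div_sub_one (by positivity)]
    exact div_ne_zero hne2 (by positivity)
  have h2 : b / a - a / b ≠ 0 := by
    rw [div_sub_div _ _ ha.ne' hb.ne']
    exact div_ne_zero (by rwa [← sq, ← sq]) (by positivity)
  have h3 : b / a - a / b = (b ^ 2 - a ^ 2) / (a * b) := by field_simp
  have h4 : b ^ 2 / a ^ 2 - 1 = (b ^ 2 - a ^ 2) / a ^ 2 := by field_simp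
  rw [h3, h4]
  field_simp
  ring

theorem Kbar0_eq {ω₀ T : ℝ} (hω₀ : 0 < ω₀) (hT : 0 < T) (x y : ℝ) :
    Kbar0 ω₀ T (T * x) (T * y)
      = (T / ω₀) ^ 2 * (convKernel (y - x) * sqrtWeight y / sqrtWeight x) := by
  have h1 : (T * y - T * x) / T = y - x := by field_simp
  have h2 : T * y / T = y := by field_simp
  unfold Kbar0 potential
  rw [h1, h2]
  rcases eq_or_ne y x with rfl | hne
  · simp [convKernel]
  rw [bose_add_fermi hne]
  unfold convKernel
  have hs : Real.sinh ((y - x) / 2) ≠ 0 := by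
    simpa [sub_eq_zero] using hne
  have hx := (sqrtWeight_pos x).ne'
  have hsign : Real.sign (T * y - T * x) / Real.sinh ((y - x) / 2)
      = 1 / |Real.sinh ((y - x) / 2)| := by
    rcases lt_or_gt_of_ne hne with h | h
    · rw [Real.sign_of_neg (by nlinarith),
        abs_of_neg (Real.sinh_neg_iff.mpr (by linarith))]
      field_simp
    · rw [Real.sign_of_pos (by nlinarith),
        abs_of_pos (Real.sinh_pos_iff.mpr (by linarith))]
  have h3 : ∀ a b c d S : ℝ, a / b / (2 * S) * (c * d) = a / b * c / 2 * (d / S) := by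
    intros; ring
  rw [h3, hsign]
  field_simp

/-- The hyperbolic sine in the denominator gives exponential decay; the weaker `(1 + z²)⁻¹` suffices
for integrability. Powers up to 2 are those occurring in `K̄₀`, `K̄₁`, `K̄₂`. -/
theorem abs_pow_mul_convKernel_le {j : ℕ} (hj : j ≤ 2) (z : ℝ) :
    |z| ^ j * convKernel z ≤ 720 * 64 * Real.exp (1 / 2) * (1 + z ^ 2)⁻¹ := by
  rcases eq_or_ne z 0 with rfl | hz
  · simp [convKernel]; positivity
  have ha : 0 < |z| := abs_pos.mpr hz
  have habs : |Real.sinh (z / 2)| = Real.sinh (|z| / 2) := by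
    rw [Real.abs_sinh, abs_div, abs_two]
  have hconv : convKernel z = |z| ^ 2 / (2 * Real.sinh (|z| / 2)) := by
    rw [convKernel, habs, sq_abs]
  rw [hconv, ← sq_abs z]
  set a := |z|
  -- The factor `a / (1 + a)` covers both regimes: linear vanishing at `0` and exponential growth at
  -- infinity.
  have hs : a / (1 + a) * Real.exp (a / 2) ≤ 2 * Real.sinh (a / 2) := by
    rw [Real.sinh_eq]
    have h1 : (1 + a) * Real.exp (-(a / 2)) ≤ Real.exp (a / 2) := by
      have h2 : 1 + a ≤ Real.exp a := by linarith [Real.add_one_le_exp a]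
      calc (1 + a) * Real.exp (-(a / 2)) ≤ Real.exp a * Real.exp (-(a / 2)) := by gcongr
        _ = _ := by rw [← Real.exp_add]; congr 1; ring
    rw [div_mul_eq_mul_div, div_le_iff₀ (by positivity)]
    linarith
  -- The sixth Taylor term of the exponential at `(1 + a) / 2`, with `720 = 6!` and `64 = 2⁶`.
  have he : (1 + a) ^ 6 ≤ 720 * 64 * Real.exp (1 / 2) * Real.exp (a / 2) := by
    have h1 := Real.pow_div_factorial_le_exp ((1 + a) / 2) (by positivity) 6
    rw [show (1 + a) / 2 = 1 / 2 + a / 2 by ring, Real.exp_add] at h1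
    norm_num [Nat.factorial] at h1 ⊢
    have h2 : (1 / 2 + a / 2) ^ 6 = (1 + a) ^ 6 / 64 := by ring
    rw [h2] at h1
    linarith
  have hsinh : 0 < Real.sinh (a / 2) := Real.sinh_pos_iff.mpr (by linarith)
  rw [← mul_div_assoc, div_le_iff₀ (by positivity), mul_assoc, ← div_eq_inv_mul, mul_div_assoc',
    le_div_iff₀ (by positivity)]
  calc a ^ j * a ^ 2 * (1 + a ^ 2)
      ≤ (1 + a) ^ 2 * a ^ 2 * (1 + a) ^ 2 := by
        have h1 : a ^ j ≤ (1 + a) ^ 2 :=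
          (pow_le_pow_left₀ ha.le (by linarith) j).trans
            (pow_le_pow_right₀ (by linarith) hj)
        have h2 : 1 + a ^ 2 ≤ (1 + a) ^ 2 := by nlinarith
        gcongr
    _ ≤ a / (1 + a) * (1 + a) ^ 6 := by
        rw [div_mul_eq_mul_div, le_div_iff₀ (by positivity)]
        have : a * (1 + a) ^ 6 - (1 + a) ^ 2 * a ^ 2 * (1 + a) ^ 2 * (1 + a)
          = a * (1 + a) ^ 5 := by ring
        have : 0 ≤ a * (1 + a) ^ 5 := by positivity
        linarith
    _ ≤ a / (1 + a) * (720 * 64 * Real.exp (1 / 2) * Real.exp (a / 2)) := by gcongr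
    _ = 720 * 64 * Real.exp (1 / 2) * (a / (1 + a) * Real.exp (a / 2)) := by ring
    _ ≤ _ := by gcongr

theorem integrable_abs_pow_mul_convKernel {j : ℕ} (hj : j ≤ 2) :
    Integrable fun z => |z| ^ j * convKernel z := by
  refine (integrable_inv_one_add_sq.const_mul (720 * 64 * Real.exp (1 / 2))).mono'
    (((continuous_abs.pow j).measurable.mul measurable_convKernel).aestronglyMeasurable)
    (Eventually.of_forall fun z => ?_)
  rw [Real.norm_of_nonneg (mul_nonneg (by positivity) (convKernel_nonneg z))]
  exact abs_pow_mul_convKernel_le hj z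

theorem integrable_convKernel : Integrable convKernel := by
  simpa using integrable_abs_pow_mul_convKernel (j := 0) (by norm_num)

theorem integral_convKernel_pos : 0 < ∫ z, convKernel z := by
  rw [integral_pos_iff_support_of_nonneg convKernel_nonneg integrable_convKernel]
  refine lt_of_lt_of_le ?_ (measure_mono (fun z hz => (convKernel_pos ?_).ne' :
    Set.Ioo (0 : ℝ) 1 ⊆ _))
  · simp
  · exact hz.1.ne'

theorem integrable_pow_mul_convKernel_mul_sqrtWeight {j : ℕ} (hj : j ≤ 2) (x : ℝ) :
    Integrable fun y => (y - x) ^ j * convKernel (y - x) * sqrtWeight y := by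
  refine (integrable_translate (integrable_abs_pow_mul_convKernel hj) x).mono'
    (Measurable.aestronglyMeasurable ?_) (Eventually.of_forall fun y => ?_)
  · exact ((by fun_prop : Measurable fun y : ℝ => (y - x) ^ j).mul
      (measurable_convKernel.comp (measurable_id.sub_const x))).mul continuous_sqrtWeight.measurable
  · rw [Real.norm_eq_abs, abs_mul, abs_mul, abs_pow, abs_of_nonneg (convKernel_nonneg _),
      abs_of_pos (sqrtWeight_pos y)]
    exact mul_le_of_le_one_right (mul_nonneg (by positivity) (convKernel_nonneg _))
      (sqrtWeight_le y)

theorem integrable_convKernel_mul_sqrtWeight (x : ℝ) :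
    Integrable fun y => convKernel (y - x) * sqrtWeight y := by
  simpa using integrable_pow_mul_convKernel_mul_sqrtWeight (j := 0) (by norm_num) x

theorem integral_convKernel_mul_sqrtWeight (x : ℝ) :
    ∫ y, convKernel (y - x) * sqrtWeight y = rate x * sqrtWeight x := by
  rw [rate, integral_div, div_mul_cancel₀ _ (sqrtWeight_pos x).ne']

theorem rate_neg (x : ℝ) : rate (-x) = rate x := by
  unfold rate
  rw [← integral_neg_eq_self]
  congr 1 with y
  rw [sqrtWeight_neg, sqrtWeight_neg, show -y - -x = -(y - x) by ring, convKernel_neg]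

theorem measurable_rate : Measurable rate := by
  have h : StronglyMeasurable (Function.uncurry fun x y : ℝ =>
      convKernel (y - x) * sqrtWeight y / sqrtWeight x) := by
    refine Measurable.stronglyMeasurable ?_
    exact ((measurable_convKernel.comp (measurable_snd.sub measurable_fst)).mul
      (continuous_sqrtWeight.measurable.comp measurable_snd)).div
        (continuous_sqrtWeight.measurable.comp measurable_fst)
  exact h.integral_prod_right.measurable

/-- The logarithm of the weight is Lipschitz, so the ratio of weights in `rate` has a lower bound
depending only on `y - x`; this bounds `rate` from below uniformly. -/
theorem exp_neg_mul_sqrtWeight_le (x y : ℝ) :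
    Real.exp (-|y - x|) * sqrtWeight x ≤ sqrtWeight y := by
  have hx := Real.cosh_pos (x / 2)
  have hy := Real.cosh_pos (y / 2)
  have hc : Real.cosh (y / 2) ≤ Real.exp |y - x| * Real.cosh (x / 2) := by
    rw [Real.cosh_eq, Real.cosh_eq]
    have h1 : Real.exp (y / 2) ≤ Real.exp |y - x| * Real.exp (x / 2) := by
      rw [← Real.exp_add, Real.exp_le_exp]
      linarith [le_abs_self (y - x), abs_nonneg (y - x)]
    have h2 : Real.exp (-(y / 2)) ≤ Real.exp |y - x| * Real.exp (-(x / 2)) := by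
      rw [← Real.exp_add, Real.exp_le_exp]
      linarith [neg_abs_le (y - x), abs_nonneg (y - x)]
    linarith
  unfold sqrtWeight
  rw [Real.exp_neg, ← div_eq_inv_mul, div_div, div_le_div_iff₀ (by positivity) (by positivity)]
  linarith

theorem exists_rate_lower_bound : ∃ γ₀ > 0, ∀ x, γ₀ ≤ rate x := by
  have hpos : ∀ z, 0 ≤ convKernel z * Real.exp (-|z|) := fun z =>
    mul_nonneg (convKernel_nonneg z) (Real.exp_pos _).le
  have hint : Integrable fun z => convKernel z * Real.exp (-|z|) := by
    refine integrable_convKernel.mono' ?_ (Eventually.of_forall fun z => ?_)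
    · exact measurable_convKernel.aestronglyMeasurable.mul
        (by fun_prop : Continuous fun z : ℝ => Real.exp (-|z|)).aestronglyMeasurable
    · rw [Real.norm_of_nonneg (hpos z)]
      exact mul_le_of_le_one_right (convKernel_nonneg z) (by simp)
  refine ⟨∫ z, convKernel z * Real.exp (-|z|), ?_, fun x => ?_⟩
  · rw [gt_iff_lt, integral_pos_iff_support_of_nonneg hpos hint]
    refine lt_of_lt_of_le ?_ (measure_mono (fun z hz =>
      (mul_pos (convKernel_pos ?_) (Real.exp_pos _)).ne' : Set.Ioo (0 : ℝ) 1 ⊆ _))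
    · simp
    · exact hz.1.ne'
  · rw [← integral_translate (fun z => convKernel z * Real.exp (-|z|)) x]
    refine integral_mono (integrable_translate hint x)
      ((integrable_convKernel_mul_sqrtWeight x).div_const _) fun y => ?_
    simp only
    rw [mul_div_assoc]
    refine mul_le_mul_of_nonneg_left ?_ (convKernel_nonneg _)
    rw [le_div_iff₀ (sqrtWeight_pos x)]
    exact exp_neg_mul_sqrtWeight_le x y

theorem rate_pos (x : ℝ) : 0 < rate x := by
  obtain ⟨γ₀, h, h'⟩ := exists_rate_lower_bound
  exact h.trans_le (h' x)

/-- For `0 ≤ y < x` the decay of `convKernel` is compensated by the ratio of weights. Integrating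
over `[0, x - 1]` makes `rate` grow at least linearly. -/
theorem half_le_of_add_one_le {x y : ℝ} (hy : 0 ≤ y) (hyx : y + 1 ≤ x) :
    1 / 2 ≤ convKernel (y - x) * sqrtWeight y / sqrtWeight x := by
  obtain ⟨s, hs, rfl⟩ : ∃ s, 1 ≤ s ∧ x = y + s := ⟨x - y, by linarith, by ring⟩
  rw [show y - (y + s) = -s by ring, convKernel_neg]
  unfold convKernel sqrtWeight
  have h1 : 0 < Real.sinh (s / 2) := Real.sinh_pos_iff.mpr (by linarith)
  have h2 := Real.cosh_pos (y / 2)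
  have h3 := Real.cosh_pos ((y + s) / 2)
  have h4 : 0 ≤ Real.sinh (y / 2) := Real.sinh_nonneg_iff.mpr (by linarith)
  have h5 : Real.cosh (y / 2) * Real.sinh (s / 2) ≤ Real.cosh ((y + s) / 2) := by
    rw [add_div, Real.cosh_add]
    have := Real.sinh_lt_cosh (s / 2)
    nlinarith [mul_nonneg h4 h1.le]
  rw [abs_of_pos h1]
  have h6 : s ^ 2 / (2 * Real.sinh (s / 2)) * (1 / (2 * Real.cosh (y / 2)))
      / (1 / (2 * Real.cosh ((y + s) / 2)))
      = s ^ 2 * Real.cosh ((y + s) / 2) / (2 * (Real.cosh (y / 2) * Real.sinh (s / 2))) := by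
    field_simp
  rw [h6, div_le_div_iff₀ (by positivity) (by positivity)]
  have : 1 ≤ s ^ 2 := by nlinarith
  nlinarith

theorem exists_le_rate (N : ℝ) : ∃ R > 0, ∀ x, R ≤ |x| → N ≤ rate x := by
  have key : ∀ x, 1 ≤ x → (x - 1) / 2 ≤ rate x := by
    intro x hx
    have hint := (integrable_convKernel_mul_sqrtWeight x).div_const (sqrtWeight x)
    have hnn : ∀ y, 0 ≤ convKernel (y - x) * sqrtWeight y / sqrtWeight x := fun y =>
      div_nonneg (mul_nonneg (convKernel_nonneg _) (sqrtWeight_pos y).le) (sqrtWeight_pos x).le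
    calc (x - 1) / 2 = ∫ y in Set.Icc 0 (x - 1), (1 / 2 : ℝ) := by
          simp [hx, div_eq_mul_inv]
      _ ≤ ∫ y in Set.Icc 0 (x - 1), convKernel (y - x) * sqrtWeight y / sqrtWeight x :=
          setIntegral_mono_on (by simp) hint.integrableOn
            measurableSet_Icc fun y hy => half_le_of_add_one_le hy.1 (by linarith [hy.2])
      _ ≤ rate x := setIntegral_le_integral hint (Eventually.of_forall hnn)
  refine ⟨2 * |N| + 1, by positivity, fun x hx => ?_⟩
  have h1 : rate x = rate |x| := by
    rcases abs_choice x with h | h <;> rw [h]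
    rw [rate_neg]
  rw [h1]
  refine le_trans ?_ (key |x| (by linarith [abs_nonneg N]))
  linarith [le_abs_self N]

theorem sqrtWeight_mul_rate_le (x : ℝ) : rate x * sqrtWeight x ≤ ∫ z, convKernel z := by
  rw [← integral_convKernel_mul_sqrtWeight, ← integral_translate convKernel x]
  refine integral_mono (integrable_convKernel_mul_sqrtWeight x)
    (integrable_translate integrable_convKernel x) fun y => ?_
  exact mul_le_of_le_one_right (convKernel_nonneg _) (sqrtWeight_le y)

theorem integrable_sqrtWeight : Integrable sqrtWeight := by
  have h1 : ∀ x, sqrtWeight x ≤ 16 * Real.exp (1 / 2) * (1 + x ^ 2)⁻¹ := by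
    intro x
    have h2 := Real.pow_div_factorial_le_exp ((1 + |x|) / 2) (by positivity) 2
    have h3 : Real.exp (|x| / 2) ≤ 2 * Real.cosh (x / 2) := by
      rw [← Real.cosh_abs, abs_div, abs_two, Real.cosh_eq]
      linarith [Real.exp_pos (-(|x| / 2))]
    rw [show (1 + |x|) / 2 = 1 / 2 + |x| / 2 by ring, Real.exp_add] at h2
    norm_num [Nat.factorial] at h2
    have h4 := Real.exp_pos (1 / 2)
    have h5 := mul_le_mul_of_nonneg_left h3 h4.le
    have h6 : 1 + x ^ 2 ≤ (1 + |x|) ^ 2 := by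
      rw [← sq_abs x]; nlinarith [abs_nonneg x]
    have h7 := Real.cosh_pos (x / 2)
    unfold sqrtWeight
    rw [← div_eq_mul_inv, div_le_div_iff₀ (by positivity) (by positivity)]
    nlinarith
  refine (integrable_inv_one_add_sq.const_mul (16 * Real.exp (1 / 2))).mono'
    continuous_sqrtWeight.aestronglyMeasurable (Eventually.of_forall fun x => ?_)
  rw [Real.norm_of_nonneg (sqrtWeight_pos x).le]
  exact h1 x

/-- Pair `z` with `-z`: `convKernel` is even and `sqrtWeight` decreases in the absolute value, so
for `x > 0` jumps towards the origin prevail. This drift is what makes the odd part nonzero. -/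
theorem integral_mul_convKernel_mul_sqrtWeight_neg {x : ℝ} (hx : 0 < x) :
    ∫ y, (y - x) * convKernel (y - x) * sqrtWeight y < 0 := by
  set F : ℝ → ℝ := fun z => z * convKernel z * sqrtWeight (z + x) with hF
  have h0 : ∫ y, (y - x) * convKernel (y - x) * sqrtWeight y = ∫ z, F z := by
    rw [← integral_translate F x]
    simp [hF]
  have hFint : Integrable F := by
    have := (integrable_pow_mul_convKernel_mul_sqrtWeight (j := 1) (by norm_num) x).comp_add_right x
    simpa [hF] using this
  have hFneg : Integrable fun z => F (-z) := hFint.comp_neg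
  have hsum : ∀ z, -(F z + F (-z))
      = convKernel z * (z * (sqrtWeight (z - x) - sqrtWeight (z + x))) := by
    intro z
    have : sqrtWeight (-z + x) = sqrtWeight (z - x) := by
      rw [← sqrtWeight_neg]; congr 1; ring
    simp only [hF, convKernel_neg, this]
    ring
  have hpos : ∀ z, z ≠ 0 → 0 < z * (sqrtWeight (z - x) - sqrtWeight (z + x)) := by
    intro z hz
    rcases lt_or_gt_of_ne hz with h | h
    · refine mul_pos_of_neg_of_neg h (sub_neg.mpr (sqrtWeight_lt_iff.mpr ?_))
      rw [← sq_lt_sq]; nlinarith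
    · refine mul_pos h (sub_pos.mpr (sqrtWeight_lt_iff.mpr ?_))
      rw [← sq_lt_sq]; nlinarith
  have hnn : ∀ z, 0 ≤ -(F z + F (-z)) := by
    intro z
    rw [hsum]
    rcases eq_or_ne z 0 with rfl | hz
    · simp
    · exact mul_nonneg (convKernel_nonneg z) (hpos z hz).le
  have h1 : 0 < ∫ z, -(F z + F (-z)) := by
    rw [integral_pos_iff_support_of_nonneg hnn (hFint.add hFneg).neg]
    refine lt_of_lt_of_le ?_ (measure_mono (fun z hz => ?_ : Set.Ioo (0 : ℝ) 1 ⊆ _))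
    · simp
    · rw [Function.mem_support, hsum]
      exact (mul_pos (convKernel_pos hz.1.ne') (hpos z hz.1.ne')).ne'
  rw [integral_neg, integral_add hFint hFneg, integral_neg_eq_self] at h1
  rw [h0]
  linarith

end ElectronPhonon

end

/-! ### The symmetrized scattering operators on `L²(ℝ)` -/

noncomputable section

namespace ElectronPhonon

open RealInnerProductSpace

/-- A positive lower bound of the dimensionless relaxation rate. -/
def rateMin : ℝ := exists_rate_lower_bound.choose

theorem rateMin_pos : 0 < rateMin := exists_rate_lower_bound.choose_spec.1

theorem rateMin_le (x : ℝ) : rateMin ≤ rate x := exists_rate_lower_bound.choose_spec.2 x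

theorem sqrt_rate_pos (x : ℝ) : 0 < √(rate x) := Real.sqrt_pos.mpr (rate_pos x)

/-- The kernel `(y-x)^j K̄₀`, symmetrized in the space `L²(ℝ)`. -/
def symKernel (j : ℕ) (x y : ℝ) : ℝ :=
  (y - x) ^ j * convKernel (y - x) / (√(rate x) * √(rate y))

theorem convDominated_symKernel {j : ℕ} (hj : j ≤ 2) :
    ConvDominated (fun z => |z| ^ j * convKernel z / rateMin) (symKernel j) where
  integrable := (integrable_abs_pow_mul_convKernel hj).div_const _
  measurable := by
    have h1 : Measurable fun p : ℝ × ℝ => p.2 - p.1 := measurable_snd.sub measurable_fst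
    exact ((h1.pow_const j).mul (measurable_convKernel.comp h1)).div
      ((measurable_rate.comp measurable_fst).sqrt.mul (measurable_rate.comp measurable_snd).sqrt)
  bound x y := by
    have h1 : rateMin ≤ √(rate x) * √(rate y) := by
      rw [← Real.mul_self_sqrt rateMin_pos.le]
      exact mul_le_mul (Real.sqrt_le_sqrt (rateMin_le x)) (Real.sqrt_le_sqrt (rateMin_le y))
        (Real.sqrt_nonneg _) (Real.sqrt_nonneg _)
    rw [symKernel, abs_div, abs_mul, abs_pow, abs_of_nonneg (convKernel_nonneg _),
      abs_of_pos (mul_pos (sqrt_rate_pos x) (sqrt_rate_pos y))]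
    exact div_le_div_of_nonneg_left (mul_nonneg (by positivity) (convKernel_nonneg _))
      rateMin_pos h1

theorem symKernel_comm (j : ℕ) (x y : ℝ) : symKernel j x y = (-1) ^ j * symKernel j y x := by
  have h : (y - x) ^ j = (-1) ^ j * (x - y) ^ j := by rw [← mul_pow]; ring_nf
  unfold symKernel
  rw [h, show y - x = -(x - y) by ring, convKernel_neg, mul_comm (√(rate y)), mul_assoc,
    mul_div_assoc]

theorem symKernel_neg (j : ℕ) (x y : ℝ) :
    symKernel j (-x) (-y) = (-1) ^ j * symKernel j x y := by
  unfold symKernel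
  rw [show -y - -x = -(y - x) by ring, convKernel_neg, neg_pow, rate_neg, rate_neg, mul_div_assoc',
    mul_assoc]

/-- The bounded operator on `L²(ℝ)` with the kernel `symKernel j`. -/
def scatOp {j : ℕ} (hj : j ≤ 2) :
    Lp ℝ 2 (volume : Measure ℝ) →L[ℝ] Lp ℝ 2 (volume : Measure ℝ) :=
  (convDominated_symKernel hj).op

/-- The factor that maps functions in `L²_σ` to functions in `L²(ℝ)`. -/
def conj (x : ℝ) : ℝ := sqrtWeight x * √(rate x)

theorem conj_pos (x : ℝ) : 0 < conj x := mul_pos (sqrtWeight_pos x) (sqrt_rate_pos x)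

theorem conj_neg (x : ℝ) : conj (-x) = conj x := by
  rw [conj, conj, sqrtWeight_neg, rate_neg]

theorem measurable_conj : Measurable conj :=
  continuous_sqrtWeight.measurable.mul measurable_rate.sqrt

theorem conj_sq (x : ℝ) : conj x ^ 2 = sqrtWeight x * (rate x * sqrtWeight x) := by
  rw [conj, mul_pow, Real.sq_sqrt (rate_pos x).le]; ring

theorem conj_sq_le (x : ℝ) : conj x ^ 2 ≤ (∫ z, convKernel z) * sqrtWeight x := by
  rw [conj_sq, mul_comm]
  exact mul_le_mul_of_nonneg_right (sqrtWeight_mul_rate_le x) (sqrtWeight_pos x).le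

theorem memLp_conj : MemLp conj 2 volume := by
  rw [memLp_two_iff_integrable_sq measurable_conj.aestronglyMeasurable]
  refine (integrable_sqrtWeight.const_mul (∫ z, convKernel z)).mono'
    (measurable_conj.pow_const 2).aestronglyMeasurable (Eventually.of_forall fun x => ?_)
  rw [Real.norm_of_nonneg (sq_nonneg _)]
  exact conj_sq_le x

/-- The source term `1 / Γ₀` as a function in `L²(ℝ)`. -/
def source (x : ℝ) : ℝ := sqrtWeight x / √(rate x)

theorem memLp_source : MemLp source 2 volume := by
  have hm : Measurable source := continuous_sqrtWeight.measurable.div measurable_rate.sqrt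
  rw [memLp_two_iff_integrable_sq hm.aestronglyMeasurable]
  refine (integrable_sqrtWeight.div_const rateMin).mono'
    (hm.pow_const 2).aestronglyMeasurable (Eventually.of_forall fun x => ?_)
  rw [Real.norm_of_nonneg (sq_nonneg _), source, div_pow, Real.sq_sqrt (rate_pos x).le]
  refine div_le_div₀ (sqrtWeight_pos x).le ?_ rateMin_pos (rateMin_le x)
  rw [sq]
  exact mul_le_of_le_one_left (sqrtWeight_pos x).le (sqrtWeight_le x)

/-- The constant function `1` of `L²_σ`, as an element of `L²(ℝ)`. -/
def oneL : Lp ℝ 2 (volume : Measure ℝ) := memLp_conj.toLp conj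

/-- The source term as an element of `L²(ℝ)`. -/
def sourceL : Lp ℝ 2 (volume : Measure ℝ) := memLp_source.toLp source

theorem coeFn_oneL : oneL =ᵐ[volume] conj := memLp_conj.coeFn_toLp

theorem coeFn_sourceL : sourceL =ᵐ[volume] source := memLp_source.coeFn_toLp

theorem reflection_oneL : reflection oneL = oneL := by
  refine Lp.ext ?_
  filter_upwards [coeFn_reflection oneL, ae_neg coeFn_oneL, coeFn_oneL] with x h1 h2 h3
  rw [h1, h2, h3, conj_neg]

theorem inner_scatOp_comm {j : ℕ} (hj : j ≤ 2) (u v : Lp ℝ 2 (volume : Measure ℝ)) :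
    ⟪scatOp hj u, v⟫ = (-1) ^ j * ⟪u, scatOp hj v⟫ :=
  (convDominated_symKernel hj).inner_op_comm (symKernel_comm j) u v

theorem reflection_scatOp {j : ℕ} (hj : j ≤ 2) (u : Lp ℝ 2 (volume : Measure ℝ)) :
    reflection (scatOp hj u) = ((-1 : ℝ) ^ j) • scatOp hj (reflection u) :=
  (convDominated_symKernel hj).reflection_op (symKernel_neg j) u

theorem coeFn_scatOp_oneL {j : ℕ} (hj : j ≤ 2) :
    scatOp hj oneL =ᵐ[volume] fun x =>
      (∫ y, (y - x) ^ j * convKernel (y - x) * sqrtWeight y) / √(rate x) := by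
  filter_upwards [(convDominated_symKernel hj).coeFn_op oneL] with x hx
  rw [scatOp, hx, ← integral_div]
  refine integral_congr_ae ?_
  filter_upwards [coeFn_oneL] with y hy
  rw [hy, symKernel, conj]
  have := (sqrt_rate_pos y).ne'
  have := (sqrt_rate_pos x).ne'
  field_simp

/-- `rate` is by definition the normalization of the kernel, so constants are preserved. -/
theorem scatOp_zero_oneL : scatOp (Nat.zero_le 2) oneL = oneL := by
  refine Lp.ext ?_
  filter_upwards [coeFn_scatOp_oneL (Nat.zero_le 2), coeFn_oneL] with x h1 h2
  simp only [pow_zero, one_mul] at h1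
  rw [h1, h2, integral_convKernel_mul_sqrtWeight, conj, div_eq_iff (sqrt_rate_pos x).ne', mul_assoc,
    Real.mul_self_sqrt (rate_pos x).le, mul_comm]

theorem integral_pos_of_pos {f : ℝ → ℝ} (hf : Integrable f) (h : ∀ᵐ x, 0 < f x) :
    0 < ∫ x, f x := by
  rw [integral_pos_iff_support_of_nonneg_ae (h.mono fun x hx => hx.le) hf]
  have h1 : (volume : Measure ℝ) (Function.support f)ᶜ = 0 :=
    measure_mono_null (fun x hx hx0 => hx (ne_of_gt hx0)) h
  by_contra h2
  have h3 : (volume : Measure ℝ) Set.univ ≤ 0 := by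
    rw [← Set.union_compl_self (Function.support f)]
    refine (measure_union_le _ _).trans ?_
    rw [h1, add_zero]
    exact not_lt.mp h2
  simp at h3

theorem inner_pos_of_pos {u v : Lp ℝ 2 (volume : Measure ℝ)} (h : ∀ᵐ x, 0 < u x * v x) :
    0 < ⟪u, v⟫ := by
  rw [L2.inner_def]
  refine integral_pos_of_pos (L2.integrable_inner u v) ?_
  filter_upwards [h] with x hx
  simpa [mul_comm] using hx

theorem inner_oneL_sourceL_pos : 0 < ⟪oneL, sourceL⟫ := by
  refine inner_pos_of_pos ?_
  filter_upwards [coeFn_oneL, coeFn_sourceL] with x h1 h2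
  rw [h1, h2]
  exact mul_pos (conj_pos x) (div_pos (sqrtWeight_pos x) (sqrt_rate_pos x))

theorem inner_scatOp_two_oneL_pos : 0 < ⟪scatOp (le_refl 2) oneL, oneL⟫ := by
  refine inner_pos_of_pos ?_
  filter_upwards [coeFn_scatOp_oneL (le_refl 2), coeFn_oneL] with x h1 h2
  rw [h1, h2]
  refine mul_pos (div_pos (integral_pos_of_pos
    (integrable_pow_mul_convKernel_mul_sqrtWeight (le_refl 2) x) ?_) (sqrt_rate_pos x)) (conj_pos x)
  filter_upwards [Measure.ae_ne volume x] with y hy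
  have h3 : y - x ≠ 0 := sub_ne_zero.mpr hy
  exact mul_pos (mul_pos (by positivity) (convKernel_pos h3)) (sqrtWeight_pos y)

theorem scatOp_one_oneL_ne_zero : scatOp one_le_two oneL ≠ 0 := by
  intro h
  have h1 := coeFn_scatOp_oneL one_le_two
  rw [h] at h1
  have h2 : ∀ᵐ x : ℝ, x ∉ Set.Ioi (0 : ℝ) := by
    filter_upwards [h1, Lp.coeFn_zero ℝ 2 (volume : Measure ℝ)] with x hx hx0 hpos
    rw [hx0] at hx
    have h3 := integral_mul_convKernel_mul_sqrtWeight_neg (Set.mem_Ioi.mp hpos)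
    simp only [pow_one] at hx
    exact (div_neg_of_neg_of_pos h3 (sqrt_rate_pos x)).ne hx.symm
  rw [ae_iff] at h2
  simp only [not_not, Set.ofPred_mem_eq] at h2
  simp at h2

/-! ### The spectral gap of the collision operator -/

section SpectralGap

/-- The density of the symmetric jump measure of the scattering process. -/
def jump (p : ℝ × ℝ) : ℝ := convKernel (p.2 - p.1) * sqrtWeight p.1 * sqrtWeight p.2

theorem jump_nonneg (p : ℝ × ℝ) : 0 ≤ jump p :=
  mul_nonneg (mul_nonneg (convKernel_nonneg _) (sqrtWeight_pos _).le) (sqrtWeight_pos _).le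

theorem jump_swap (p : ℝ × ℝ) : jump p.swap = jump p := by
  unfold jump
  rw [Prod.fst_swap, Prod.snd_swap, ← convKernel_neg, neg_sub]
  ring

theorem measurable_jump : Measurable jump :=
  ((measurable_convKernel.comp (measurable_snd.sub measurable_fst)).mul
    (continuous_sqrtWeight.measurable.comp measurable_fst)).mul
      (continuous_sqrtWeight.measurable.comp measurable_snd)

variable (u : Lp ℝ 2 (volume : Measure ℝ))

theorem aestronglyMeasurable_div_conj :
    AEStronglyMeasurable (fun x => u x / conj x) volume :=
  ((Lp.aestronglyMeasurable u).aemeasurable.div measurable_conj.aemeasurable).aestronglyMeasurable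

/-- The marginal of the symmetric density `jump` is `conj²`. -/
theorem integral_jump_mul_sq (x : ℝ) : ∫ y, jump (x, y) * (u x / conj x) ^ 2 = u x ^ 2 := by
  have h1 : ∀ y, jump (x, y) * (u x / conj x) ^ 2
      = (sqrtWeight x * (u x / conj x) ^ 2) * (convKernel (y - x) * sqrtWeight y) := fun y => by
    simp only [jump]; ring
  simp_rw [h1]
  rw [integral_const_mul, integral_convKernel_mul_sqrtWeight, div_pow, conj_sq]
  have := (sqrtWeight_pos x).ne'
  have := (rate_pos x).ne'
  field_simp

theorem integrable_jump_mul_sq_fst :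
    Integrable (fun p : ℝ × ℝ => jump p * (u p.1 / conj p.1) ^ 2) (volume.prod volume) := by
  rw [integrable_prod_iff]
  · constructor
    · refine Eventually.of_forall fun x => ?_
      refine ((integrable_convKernel_mul_sqrtWeight x).const_mul
        (sqrtWeight x * (u x / conj x) ^ 2)).congr (Eventually.of_forall fun y => ?_)
      simp only [jump]; ring
    · refine (Lp.memLp u).integrable_sq.congr (Eventually.of_forall fun x => ?_)
      simp only
      rw [← integral_jump_mul_sq u x]
      congr 1 with y
      rw [Real.norm_of_nonneg (mul_nonneg (jump_nonneg _) (sq_nonneg _))]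
  · exact measurable_jump.aestronglyMeasurable.mul
      ((aestronglyMeasurable_div_conj u).comp_fst.pow 2)

theorem integrable_jump_mul_sq_snd :
    Integrable (fun p : ℝ × ℝ => jump p * (u p.2 / conj p.2) ^ 2) (volume.prod volume) := by
  refine (integrable_jump_mul_sq_fst u).swap.congr (Eventually.of_forall fun p => ?_)
  simp only [Function.comp, jump_swap, Prod.fst_swap]

theorem jump_mul_mul (p : ℝ × ℝ) :
    jump p * ((u p.1 / conj p.1) * (u p.2 / conj p.2))
      = symKernel 0 p.1 p.2 * u p.2 * u p.1 := by
  have h1 := (sqrtWeight_pos p.1).ne'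
  have h2 := (sqrtWeight_pos p.2).ne'
  have h3 := (sqrt_rate_pos p.1).ne'
  have h4 := (sqrt_rate_pos p.2).ne'
  unfold jump symKernel conj
  field_simp

theorem jump_mul_sub_sq (p : ℝ × ℝ) :
    jump p * (u p.1 / conj p.1 - u p.2 / conj p.2) ^ 2
      = jump p * (u p.1 / conj p.1) ^ 2 + jump p * (u p.2 / conj p.2) ^ 2
        - 2 * (symKernel 0 p.1 p.2 * u p.2 * u p.1) := by
  rw [← jump_mul_mul]; ring

theorem integrable_energy :
    Integrable (fun p : ℝ × ℝ => jump p * (u p.1 / conj p.1 - u p.2 / conj p.2) ^ 2)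
      (volume.prod volume) := by
  simp_rw [jump_mul_sub_sq]
  exact ((integrable_jump_mul_sq_fst u).add (integrable_jump_mul_sq_snd u)).sub
    (((convDominated_symKernel (Nat.zero_le 2)).integrable_prod
      (Lp.memLp u) (Lp.memLp u)).const_mul 2)

/-- The quadratic form of `1 - S₀` is half the Dirichlet form of the jump process, evaluated at the
unconjugated function `u / conj`. -/
theorem integral_energy :
    ∫ p, jump p * (u p.1 / conj p.1 - u p.2 / conj p.2) ^ 2 ∂(volume.prod volume)
      = 2 * (‖u‖ ^ 2 - ⟪scatOp (Nat.zero_le 2) u, u⟫) := by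
  have h1 := integrable_jump_mul_sq_fst u
  have h2 := integrable_jump_mul_sq_snd u
  have h3 := ((convDominated_symKernel (Nat.zero_le 2)).integrable_prod
      (Lp.memLp u) (Lp.memLp u)).const_mul 2
  have h12 : Integrable (fun p : ℝ × ℝ => jump p * (u p.1 / conj p.1) ^ 2
      + jump p * (u p.2 / conj p.2) ^ 2) (volume.prod volume) := h1.add h2
  have e1 : ∫ p : ℝ × ℝ, jump p * (u p.1 / conj p.1) ^ 2 ∂(volume.prod volume) = ‖u‖ ^ 2 := by
    rw [integral_prod _ h1, Lp_norm_sq_eq_integral]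
    simp_rw [integral_jump_mul_sq]
  have e2 : ∫ p : ℝ × ℝ, jump p * (u p.2 / conj p.2) ^ 2 ∂(volume.prod volume) = ‖u‖ ^ 2 := by
    rw [← e1, ← integral_prod_swap]
    simp only [jump_swap, Prod.snd_swap]
  simp_rw [jump_mul_sub_sq]
  rw [integral_sub h12 h3, integral_add h1 h2, e1, e2, integral_const_mul, scatOp,
    ConvDominated.inner_op]
  ring

theorem sqrtWeight_anti {x y : ℝ} (h : |x| ≤ |y|) : sqrtWeight y ≤ sqrtWeight x :=
  not_lt.mp fun h' => (sqrtWeight_lt_iff.mp h').not_ge h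

/-- `jump` vanishes on the diagonal, so it has no positive lower bound on a square around the
origin. Comparing with points at distance at least one avoids this. -/
theorem exists_le_jump (R : ℝ) (hR : 0 < R) : ∃ k > 0, ∀ x ∈ Set.Icc (-R) R,
    ∀ y ∈ Set.Icc (R + 1) (R + 2), k ≤ jump (x, y) := by
  have hs : 0 < Real.sinh (R + 1) := Real.sinh_pos_iff.mpr (by linarith)
  have hq := sqrtWeight_pos (R + 2)
  refine ⟨1 / (2 * Real.sinh (R + 1)) * sqrtWeight (R + 2) * sqrtWeight (R + 2),
    by positivity, fun x hx y hy => ?_⟩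
  have hz1 : 1 ≤ y - x := by linarith [hx.2, hy.1]
  have hz2 : y - x ≤ 2 * (R + 1) := by linarith [hx.1, hy.2]
  have h1 : 1 / (2 * Real.sinh (R + 1)) ≤ convKernel (y - x) := by
    have h2 : 0 < Real.sinh ((y - x) / 2) := Real.sinh_pos_iff.mpr (by linarith)
    have h3 : Real.sinh ((y - x) / 2) ≤ Real.sinh (R + 1) :=
      Real.sinh_le_sinh.mpr (by linarith)
    rw [convKernel, abs_of_pos h2]
    exact div_le_div₀ (sq_nonneg _) (by nlinarith) (by positivity) (by linarith)
  have h4 : sqrtWeight (R + 2) ≤ sqrtWeight x := sqrtWeight_anti (by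
    rw [abs_of_pos (by linarith : 0 < R + 2)]
    exact abs_le.mpr ⟨by linarith [hx.1], by linarith [hx.2]⟩)
  have h5 : sqrtWeight (R + 2) ≤ sqrtWeight y := sqrtWeight_anti (by
    rw [abs_of_pos (by linarith : 0 < R + 2)]
    exact abs_le.mpr ⟨by linarith [hy.1], by linarith [hy.2]⟩)
  have h6 := convKernel_nonneg (y - x)
  have h7 := (sqrtWeight_pos x).le
  unfold jump
  gcongr

/-- The Poincaré inequality on a bounded interval. -/
theorem exists_local_poincare (R : ℝ) (hR : 0 < R) : ∃ C ≥ 0, ∀ u : Lp ℝ 2 (volume : Measure ℝ),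
    ∃ m : ℝ, ∫ x in Set.Icc (-R) R, (u x - m * conj x) ^ 2
      ≤ C * (‖u‖ ^ 2 - ⟪scatOp (Nat.zero_le 2) u, u⟫) := by
  obtain ⟨k, hk, hjump⟩ := exists_le_jump R hR
  set N := ∫ z, convKernel z with hN
  have hN0 : 0 < N := integral_convKernel_pos
  refine ⟨N / k * 2, by positivity, fun u => ?_⟩
  set F : ℝ × ℝ → ℝ := fun p => jump p * (u p.1 / conj p.1 - u p.2 / conj p.2) ^ 2 with hF
  have hF0 : ∀ p, 0 ≤ F p := fun p => mul_nonneg (jump_nonneg p) (sq_nonneg _)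
  have hFint : Integrable F (volume.prod volume) := integrable_energy u
  set I : Set ℝ := Set.Icc (R + 1) (R + 2) with hI
  have hIvol : volume I = 1 := by rw [hI, Real.volume_Icc]; norm_num
  have hGint : Integrable fun t => ∫ x, F (x, t) := hFint.integral_prod_right
  have hnull : (volume.restrict I) ({t | Integrable fun x => F (x, t)}ᶜ ∪ Iᶜ) = 0 := by
    refine measure_union_null ?_ ?_
    · exact Measure.absolutelyContinuous_of_le Measure.restrict_le_self hFint.prod_left_ae
    · rw [Measure.restrict_apply measurableSet_Icc.compl, Set.compl_inter_self, measure_empty]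
  have hne : volume.restrict I ≠ 0 := by
    rw [Ne, Measure.restrict_eq_zero, hIvol]
    exact one_ne_zero
  have : IsFiniteMeasure (volume.restrict I) := ⟨by
    rw [Measure.restrict_apply_univ, hIvol]; exact ENNReal.one_lt_top⟩
  -- Some reference point `t` of `I` has an energy slice not exceeding the average over `I`; the
  -- null set excludes nonintegrable slices and points outside `I`. The constant `m` is the value of
  -- `u / conj` at `t`.
  obtain ⟨t, ht, hle⟩ := exists_notMem_null_le_average hne hGint.integrableOn hnull
  simp only [Set.mem_union, Set.mem_compl_iff, Set.mem_ofPred_eq, not_or, not_not] at ht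
  have hG : ∫ x, F (x, t) ≤ 2 * (‖u‖ ^ 2 - ⟪scatOp (Nat.zero_le 2) u, u⟫) := by
    refine hle.trans ?_
    rw [average_eq, measureReal_def, Measure.restrict_apply_univ, hIvol, ENNReal.toReal_one,
      inv_one, one_smul, ← integral_energy u, integral_prod_symm _ hFint]
    exact setIntegral_le_integral hGint
      (Eventually.of_forall fun t => integral_nonneg fun x => hF0 _)
  refine ⟨u t / conj t, ?_⟩
  have hpt : ∀ x ∈ Set.Icc (-R) R,
      (u x - u t / conj t * conj x) ^ 2 ≤ N / k * F (x, t) := by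
    intro x hx
    have h1 : u x - u t / conj t * conj x = conj x * (u x / conj x - u t / conj t) := by
      have := (conj_pos x).ne'
      field_simp
    have h2 : conj x ^ 2 ≤ N := (conj_sq_le x).trans
      (mul_le_of_le_one_right hN0.le (sqrtWeight_le x))
    have h3 := hjump x hx t ht.2
    rw [h1, mul_pow, hF, ← mul_assoc]
    refine mul_le_mul_of_nonneg_right (h2.trans ?_) (sq_nonneg _)
    rw [div_mul_eq_mul_div, le_div_iff₀ hk]
    exact mul_le_mul_of_nonneg_left h3 hN0.le
  calc ∫ x in Set.Icc (-R) R, (u x - u t / conj t * conj x) ^ 2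
      ≤ ∫ x in Set.Icc (-R) R, N / k * F (x, t) := by
        refine integral_mono_of_nonneg (Eventually.of_forall fun x => sq_nonneg _)
          (ht.1.const_mul _).integrableOn ?_
        filter_upwards [ae_restrict_mem measurableSet_Icc] with x hx using hpt x hx
    _ ≤ ∫ x, N / k * F (x, t) := setIntegral_le_integral (ht.1.const_mul _)
        (Eventually.of_forall fun x => mul_nonneg (by positivity) (hF0 _))
    _ = N / k * ∫ x, F (x, t) := integral_const_mul _ _
    _ ≤ N / k * (2 * (‖u‖ ^ 2 - ⟪scatOp (Nat.zero_le 2) u, u⟫)) :=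
        mul_le_mul_of_nonneg_left hG (by positivity)
    _ = _ := by ring

/-- The inequality `2ab ≤ a² + b²` for `v / √rate` at the two points, followed by integrating out
the kernel. The bound is small where `rate` is large. -/
theorem inner_scatOp_zero_le (v : Lp ℝ 2 (volume : Measure ℝ)) :
    ⟪scatOp (Nat.zero_le 2) v, v⟫ ≤ ∫ x, (∫ z, convKernel z) * (v x ^ 2 / rate x) := by
  have hi : Integrable fun x => v x ^ 2 / rate x := by
    refine ((Lp.memLp v).integrable_sq.div_const rateMin).mono'
      ((((Lp.aestronglyMeasurable v).aemeasurable.pow_const 2).div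
        measurable_rate.aemeasurable).aestronglyMeasurable) (Eventually.of_forall fun x => ?_)
    rw [Real.norm_of_nonneg (div_nonneg (sq_nonneg _) (rate_pos x).le)]
    exact div_le_div_of_nonneg_left (sq_nonneg _) rateMin_pos (rateMin_le x)
  have h1 := integrable_kernel_mul_fst integrable_convKernel hi
  have h2 := integrable_kernel_mul_snd integrable_convKernel hi
  have e2 : ∫ p : ℝ × ℝ, convKernel (p.2 - p.1) * (v p.1 ^ 2 / rate p.1) ∂(volume.prod volume)
      = ∫ x, (∫ z, convKernel z) * (v x ^ 2 / rate x) := by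
    rw [integral_prod _ h1]
    simp_rw [integral_mul_const, integral_translate]
  have e3 : ∫ p : ℝ × ℝ, convKernel (p.2 - p.1) * (v p.2 ^ 2 / rate p.2) ∂(volume.prod volume)
      = ∫ x, (∫ z, convKernel z) * (v x ^ 2 / rate x) := by
    rw [← e2, ← integral_prod_swap]
    congr 1 with p
    rw [Prod.fst_swap, Prod.snd_swap, ← convKernel_neg, neg_sub]
  have h3 : Integrable (fun p : ℝ × ℝ => convKernel (p.2 - p.1) * (v p.1 ^ 2 / rate p.1)
      + convKernel (p.2 - p.1) * (v p.2 ^ 2 / rate p.2)) (volume.prod volume) := h1.add h2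
  rw [scatOp, ConvDominated.inner_op]
  calc ∫ p, symKernel 0 p.1 p.2 * v p.2 * v p.1 ∂(volume.prod volume)
      ≤ ∫ p : ℝ × ℝ, (convKernel (p.2 - p.1) * (v p.1 ^ 2 / rate p.1)
      + convKernel (p.2 - p.1) * (v p.2 ^ 2 / rate p.2)) / 2 ∂(volume.prod volume) := by
        refine integral_mono ((convDominated_symKernel (Nat.zero_le 2)).integrable_prod
          (Lp.memLp v) (Lp.memLp v)) (h3.div_const 2) fun p => ?_
        simp only [symKernel, pow_zero, one_mul]
        have ha := sqrt_rate_pos p.1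
        have hb := sqrt_rate_pos p.2
        have e : ∀ x, v x ^ 2 / rate x = (v x / √(rate x)) ^ 2 := fun x => by
          rw [div_pow, Real.sq_sqrt (rate_pos x).le]
        rw [e, e]
        have e4 : convKernel (p.2 - p.1) / (√(rate p.1) * √(rate p.2)) * v p.2 * v p.1
            = convKernel (p.2 - p.1) * ((v p.1 / √(rate p.1)) * (v p.2 / √(rate p.2))) := by
          field_simp
        rw [e4]
        nlinarith [mul_nonneg (convKernel_nonneg (p.2 - p.1))
          (sq_nonneg (v p.1 / √(rate p.1) - v p.2 / √(rate p.2)))]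
    _ = _ := by
        rw [integral_div, integral_add h1 h2, e2, e3]
        ring

/-- The collision operator `1 - K₀` in `L²(ℝ)`. -/
def collisionOp : Lp ℝ 2 (volume : Measure ℝ) →L[ℝ] Lp ℝ 2 (volume : Measure ℝ) :=
  ContinuousLinearMap.id ℝ _ - scatOp (Nat.zero_le 2)

theorem collisionOp_apply (u : Lp ℝ 2 (volume : Measure ℝ)) :
    collisionOp u = u - scatOp (Nat.zero_le 2) u := rfl

theorem collisionOp_oneL : collisionOp oneL = 0 := by
  rw [collisionOp_apply, scatOp_zero_oneL, sub_self]

theorem inner_collisionOp_comm (u v : Lp ℝ 2 (volume : Measure ℝ)) :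
    ⟪collisionOp u, v⟫ = ⟪u, collisionOp v⟫ := by
  rw [collisionOp_apply, collisionOp_apply, inner_sub_left, inner_sub_right, inner_scatOp_comm,
    pow_zero, one_mul]

theorem inner_collisionOp_self (u : Lp ℝ 2 (volume : Measure ℝ)) :
    ⟪collisionOp u, u⟫ = ‖u‖ ^ 2 - ⟪scatOp (Nat.zero_le 2) u, u⟫ := by
  rw [collisionOp_apply, inner_sub_left, real_inner_self_eq_norm_sq]

theorem reflection_collisionOp (u : Lp ℝ 2 (volume : Measure ℝ)) :
    reflection (collisionOp u) = collisionOp (reflection u) := by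
  rw [collisionOp_apply, collisionOp_apply, map_sub, reflection_scatOp, pow_zero, one_smul]

/-- The spectral gap of the collision operator. -/
theorem exists_spectral_gap : ∃ κ > 0, ∀ u : Lp ℝ 2 (volume : Measure ℝ),
    ∃ m : ℝ, κ * ‖u - m • oneL‖ ^ 2 ≤ ⟪collisionOp u, u⟫ := by
  set N := ∫ z, convKernel z with hN
  have hN0 : 0 < N := integral_convKernel_pos
  -- Outside `[-R, R]` the factor `N / rate` is at most `1 / 2`, so that contribution can be
  -- absorbed into `‖v‖²`; inside, the local Poincaré inequality applies.
  obtain ⟨R, hR, hrate⟩ := exists_le_rate (2 * N)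
  obtain ⟨C, hC, hloc⟩ := exists_local_poincare R hR
  have hr0 := rateMin_pos
  refine ⟨(2 * (1 + N / rateMin * C))⁻¹, by positivity, fun u => ?_⟩
  obtain ⟨m, hm⟩ := hloc u
  refine ⟨m, ?_⟩
  rw [← inner_collisionOp_self] at hm
  set v := u - m • oneL with hv
  -- By symmetry the form does not see the null vector.
  have hAv : ⟪collisionOp v, v⟫ = ⟪collisionOp u, u⟫ := by
    have h1 : collisionOp v = collisionOp u := by
      rw [hv, map_sub, map_smul, collisionOp_oneL, smul_zero, sub_zero]
    rw [h1, hv, inner_sub_right, inner_smul_right, inner_collisionOp_comm u oneL,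
      collisionOp_oneL, inner_zero_right, mul_zero, sub_zero]
  have hvae : v =ᵐ[volume] fun x => u x - m * conj x := by
    filter_upwards [Lp.coeFn_sub u (m • oneL), Lp.coeFn_smul m oneL, coeFn_oneL] with x h1 h2 h3
    rw [hv, h1, Pi.sub_apply, h2, Pi.smul_apply, h3, smul_eq_mul]
  have hloc' : ∫ x in Set.Icc (-R) R, v x ^ 2 ≤ C * ⟪collisionOp u, u⟫ := by
    refine le_trans (le_of_eq (integral_congr_ae (ae_restrict_of_ae ?_))) hm
    filter_upwards [hvae] with x hx
    simp only [hx]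
  have hsq := (Lp.memLp v).integrable_sq
  have hind : Integrable ((Set.Icc (-R) R).indicator fun x => v x ^ 2) :=
    hsq.indicator measurableSet_Icc
  have hbound : ∀ x, N * (v x ^ 2 / rate x) ≤ 1 / 2 * v x ^ 2
      + N / rateMin * (Set.Icc (-R) R).indicator (fun x => v x ^ 2) x := by
    intro x
    by_cases hx : x ∈ Set.Icc (-R) R
    · rw [Set.indicator_of_mem hx]
      have h1 : N * (v x ^ 2 / rate x) ≤ N * (v x ^ 2 / rateMin) :=
        mul_le_mul_of_nonneg_left
          (div_le_div_of_nonneg_left (sq_nonneg _) rateMin_pos (rateMin_le x)) hN0.le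
      have h2 : N * (v x ^ 2 / rateMin) = N / rateMin * v x ^ 2 := by ring
      nlinarith [sq_nonneg (v x)]
    · rw [Set.indicator_of_notMem hx, mul_zero, add_zero, mul_div_assoc',
        div_le_iff₀ (rate_pos x)]
      have h1 : 2 * N ≤ rate x := hrate x (by
        by_contra h
        exact hx (abs_le.mp (not_le.mp h).le))
      nlinarith [mul_le_mul_of_nonneg_left h1 (sq_nonneg (v x))]
  have h1 : ⟪scatOp (Nat.zero_le 2) v, v⟫
      ≤ 1 / 2 * ‖v‖ ^ 2 + N / rateMin * (C * ⟪collisionOp u, u⟫) := by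
    refine (inner_scatOp_zero_le v).trans ?_
    have h2 : ∫ x, N * (v x ^ 2 / rate x) ≤ ∫ x, (1 / 2 * v x ^ 2
        + N / rateMin * (Set.Icc (-R) R).indicator (fun x => v x ^ 2) x) := by
      refine integral_mono_of_nonneg (Eventually.of_forall fun x => ?_)
        ((hsq.const_mul _).add (hind.const_mul _)) (Eventually.of_forall hbound)
      exact mul_nonneg hN0.le (div_nonneg (sq_nonneg _) (rate_pos x).le)
    refine h2.trans ?_
    rw [integral_add (hsq.const_mul _) (hind.const_mul _), integral_const_mul, integral_const_mul,
      integral_indicator measurableSet_Icc, ← Lp_norm_sq_eq_integral]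
    gcongr
  rw [← hAv, inner_collisionOp_self, inv_mul_le_iff₀ (by positivity)]
  rw [← hAv, inner_collisionOp_self] at h1
  nlinarith

end SpectralGap

end ElectronPhonon

end

/-! ### Rescaling the energy by the temperature -/

noncomputable section

namespace ElectronPhonon

section Scaling

theorem quasiMeasurePreserving_mul_left {T : ℝ} (hT : T ≠ 0) :
    Measure.QuasiMeasurePreserving (fun x : ℝ => T * x) volume volume :=
  ⟨measurable_const_mul T, by
    rw [Real.map_volume_mul_left hT]
    exact Measure.smul_absolutelyContinuous⟩

theorem ae_mul_left_iff {T : ℝ} (hT : T ≠ 0) {p : ℝ → Prop} :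
    (∀ᵐ x, p (T * x)) ↔ ∀ᵐ x, p x := by
  refine ⟨fun h => ?_, fun h => (quasiMeasurePreserving_mul_left hT).ae h⟩
  have := (quasiMeasurePreserving_mul_left (inv_ne_zero hT)).ae h
  simpa [mul_inv_cancel_left₀ hT] using this

theorem lintegral_eq_ofReal_mul_lintegral {T : ℝ} (hT : 0 < T) (f : ℝ → ENNReal) :
    ∫⁻ x, f x = ENNReal.ofReal T * ∫⁻ x, f (T * x) := by
  have h := Real.smul_map_volume_mul_left hT.ne'
  conv_lhs => rw [← h]
  rw [lintegral_smul_measure, abs_of_pos hT, smul_eq_mul,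
    (measurableEmbedding_mulLeft₀ hT.ne').lintegral_map]

variable {ω₀ T : ℝ}

theorem Gamma0_eq (hω₀ : 0 < ω₀) (hT : 0 < T) (x : ℝ) :
    Gamma0 ω₀ T (T * x) = T ^ 3 / ω₀ ^ 2 * rate x := by
  have h := Measure.integral_comp_mul_left (fun u => Kbar0 ω₀ T (T * x) u) T
  simp_rw [Kbar0_eq hω₀ hT, integral_const_mul] at h
  rw [abs_of_pos (inv_pos.mpr hT), smul_eq_mul] at h
  rw [Gamma0, rate]
  field_simp at h ⊢
  linarith

theorem density_eq (hω₀ : 0 < ω₀) (hT : 0 < T) (x : ℝ) :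
    weight T (T * x) * Gamma0 ω₀ T (T * x) = T ^ 3 / ω₀ ^ 2 * conj x ^ 2 := by
  rw [weight_eq, Gamma0_eq hω₀ hT, conj_sq, mul_div_cancel_left₀ _ hT.ne']
  ring

theorem density_eq' (hω₀ : 0 < ω₀) (hT : 0 < T) :
    (fun ε => weight T ε * Gamma0 ω₀ T ε) = fun ε => T ^ 3 / ω₀ ^ 2 * conj (ε / T) ^ 2 := by
  funext ε
  rw [← density_eq hω₀ hT, mul_div_cancel₀ _ hT.ne']

theorem measurable_density (hω₀ : 0 < ω₀) (hT : 0 < T) :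
    Measurable fun ε => ENNReal.ofReal (weight T ε * Gamma0 ω₀ T ε) := by
  refine Measurable.ennreal_ofReal ?_
  rw [density_eq' hω₀ hT]
  exact ((measurable_conj.comp (measurable_id.div_const T)).pow_const 2).const_mul _

theorem aestronglyMeasurable_sigma_iff (hω₀ : 0 < ω₀) (hT : 0 < T) {f : ℝ → ℝ} :
    AEStronglyMeasurable f (sigma ω₀ T) ↔ AEStronglyMeasurable f volume := by
  refine ⟨fun h => h.mono_ac ?_, fun h => h.mono_ac (withDensity_absolutelyContinuous _ _)⟩
  refine withDensity_absolutelyContinuous' (measurable_density hω₀ hT).aemeasurable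
    (Eventually.of_forall fun ε => ?_)
  have h := congrFun (density_eq' hω₀ hT) ε
  have := conj_pos (ε / T)
  simp only [h, ne_eq, ENNReal.ofReal_eq_zero, not_le]
  positivity

theorem aestronglyMeasurable_scaling_iff (hT : 0 < T) {f : ℝ → ℝ} :
    AEStronglyMeasurable (fun x => conj x * f (T * x)) volume ↔
      AEStronglyMeasurable f volume := by
  constructor
  · intro h
    have h1 : AEStronglyMeasurable (fun x => f (T * x)) volume := by
      refine (h.aemeasurable.div measurable_conj.aemeasurable).aestronglyMeasurable.congr
        (Eventually.of_forall fun x => ?_)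
      exact mul_div_cancel_left₀ _ (conj_pos x).ne'
    have h2 := h1.comp_quasiMeasurePreserving
      (quasiMeasurePreserving_mul_left (inv_ne_zero hT.ne'))
    refine h2.congr (Eventually.of_forall fun x => ?_)
    simp [mul_inv_cancel_left₀ hT.ne']
  · intro h
    exact measurable_conj.aestronglyMeasurable.mul
      (h.comp_quasiMeasurePreserving (quasiMeasurePreserving_mul_left hT.ne'))

/-- The density contributes `T³/ω₀²` and `dε = T dx` one more `T`; the prefactor is the square root
of the product. It does not depend on `f`, so it cancels in ratios of norms. -/
theorem eLpNorm_sigma (hω₀ : 0 < ω₀) (hT : 0 < T) (f : ℝ → ℝ) :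
    eLpNorm f 2 (sigma ω₀ T)
      = ENNReal.ofReal (T ^ 2 / ω₀) * eLpNorm (fun x => conj x * f (T * x)) 2 volume := by
  rw [eLpNorm_eq_lintegral_rpow_enorm_toReal two_ne_zero ENNReal.ofNat_ne_top,
    eLpNorm_eq_lintegral_rpow_enorm_toReal two_ne_zero ENNReal.ofNat_ne_top]
  have h1 : ∫⁻ ε, ‖f ε‖ₑ ^ (2 : ENNReal).toReal ∂(sigma ω₀ T)
      = ENNReal.ofReal (T ^ 2 / ω₀) ^ (2 : ℝ)
        * ∫⁻ x, ‖conj x * f (T * x)‖ₑ ^ (2 : ENNReal).toReal := by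
    rw [sigma, lintegral_withDensity_eq_lintegral_mul_non_measurable _
      (measurable_density hω₀ hT) (Eventually.of_forall fun ε => ENNReal.ofReal_lt_top),
      lintegral_eq_ofReal_mul_lintegral hT, ← lintegral_const_mul' _ _ ENNReal.ofReal_ne_top,
      ← lintegral_const_mul' _ _ (by simp)]
    congr 1 with x
    have hc := conj_pos x
    simp only [Pi.mul_apply, density_eq hω₀ hT, enorm_mul, ENNReal.toReal_ofNat,
      ENNReal.mul_rpow_of_nonneg _ _ (zero_le_two : (0 : ℝ) ≤ 2)]
    rw [Real.enorm_of_nonneg hc.le, ← mul_assoc, ← mul_assoc,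
      ENNReal.ofReal_rpow_of_nonneg (by positivity) zero_le_two,
      ENNReal.ofReal_rpow_of_nonneg hc.le zero_le_two, ← ENNReal.ofReal_mul hT.le,
      ← ENNReal.ofReal_mul (by positivity)]
    congr 2
    rw [Real.rpow_two, Real.rpow_two]
    field_simp
  rw [h1, ENNReal.mul_rpow_of_nonneg _ _ (by positivity), ← ENNReal.rpow_mul]
  simp

theorem memLp_sigma_iff (hω₀ : 0 < ω₀) (hT : 0 < T) {f : ℝ → ℝ} :
    MemLp f 2 (sigma ω₀ T) ↔ MemLp (fun x => conj x * f (T * x)) 2 volume := by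
  have h0 : ENNReal.ofReal (T ^ 2 / ω₀) ≠ 0 := by
    rw [Ne, ENNReal.ofReal_eq_zero, not_le]; positivity
  rw [MemLp, MemLp, aestronglyMeasurable_sigma_iff hω₀ hT, aestronglyMeasurable_scaling_iff hT,
    eLpNorm_sigma hω₀ hT, ENNReal.mul_lt_top_iff]
  refine and_congr_right fun _ => ⟨fun h => ?_, fun h => Or.inl ⟨ENNReal.ofReal_lt_top, h⟩⟩
  rcases h with h | h | h
  · exact h.2
  · exact absurd h h0
  · rw [h]; exact ENNReal.zero_lt_top

variable {εF : ℝ}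

theorem conj_mul_K (hω₀ : 0 < ω₀) (hT : 0 < T) (x y : ℝ) :
    conj x * K ω₀ εF T (T * x) (T * y)
      = T⁻¹ * ((symKernel 0 x y + T * (1 / (2 * εF)) * symKernel 1 x y
        - T ^ 2 * (1 / (2 * ω₀ ^ 2)) * symKernel 2 x y) * conj y) := by
  have h1 : (T * y - T * x) / T = y - x := by field_simp
  have hr : √(rate x) ^ 2 = rate x := Real.sq_sqrt (rate_pos x).le
  unfold K Kbar1 Kbar2 conj symKernel
  rw [Gamma0_eq hω₀ hT, Kbar0_eq hω₀ hT, h1]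
  have hx := (sqrtWeight_pos x).ne'
  have hgx := (sqrt_rate_pos x).ne'
  generalize √(rate x) = g at hr hgx ⊢
  rw [← hr]
  have hgy := (sqrt_rate_pos y).ne'
  -- For `εF = 0` the coefficients of the first-order term on both sides are zero by the convention
  -- for division.
  rcases eq_or_ne εF 0 with rfl | hεF
  · simp only [mul_zero, div_zero, zero_mul, add_zero]
    field_simp
    ring
  field_simp

theorem integral_K_mul (hω₀ : 0 < ω₀) (hT : 0 < T) {φ u : ℝ → ℝ}
    (hu : u =ᵐ[volume] fun x => conj x * φ (T * x)) {x : ℝ}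
    (h0 : Integrable fun y => symKernel 0 x y * u y)
    (h1 : Integrable fun y => symKernel 1 x y * u y)
    (h2 : Integrable fun y => symKernel 2 x y * u y) :
    Integrable (fun v => K ω₀ εF T (T * x) v * φ v) ∧
      conj x * ∫ v, K ω₀ εF T (T * x) v * φ v
        = (∫ y, symKernel 0 x y * u y) + T * (1 / (2 * εF)) * (∫ y, symKernel 1 x y * u y)
          - T ^ 2 * (1 / (2 * ω₀ ^ 2)) * ∫ y, symKernel 2 x y * u y := by
  have hx := (conj_pos x).ne'
  have h01 : Integrable fun y => symKernel 0 x y * u y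
      + T * (1 / (2 * εF)) * (symKernel 1 x y * u y) := h0.add (h1.const_mul _)
  have hI := h01.sub (h2.const_mul (T ^ 2 * (1 / (2 * ω₀ ^ 2))))
  have hae : (fun y => K ω₀ εF T (T * x) (T * y) * φ (T * y)) =ᵐ[volume]
      fun y => (conj x)⁻¹ * T⁻¹ * (symKernel 0 x y * u y
        + T * (1 / (2 * εF)) * (symKernel 1 x y * u y)
        - T ^ 2 * (1 / (2 * ω₀ ^ 2)) * (symKernel 2 x y * u y)) := by
    filter_upwards [hu] with y hy
    have h3 : K ω₀ εF T (T * x) (T * y) = (conj x)⁻¹ * (conj x * K ω₀ εF T (T * x) (T * y)) := by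
      field_simp
    rw [h3, conj_mul_K hω₀ hT, hy]
    ring
  constructor
  · rw [← integrable_comp_mul_left_iff _ hT.ne']
    exact (hI.const_mul _).congr hae.symm
  · have h4 := Measure.integral_comp_mul_left (fun v => K ω₀ εF T (T * x) v * φ v) T
    rw [integral_congr_ae hae, integral_const_mul, integral_sub h01 (h2.const_mul _),
      integral_add h0 (h1.const_mul _), integral_const_mul, integral_const_mul,
      abs_of_pos (inv_pos.mpr hT), smul_eq_mul] at h4
    have h5 := congrArg (fun r => T * conj x * r) h4
    have h6 : ∀ r, T * conj x * (T⁻¹ * r) = conj x * r := fun r => by field_simp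
    have h7 : ∀ r, T * conj x * ((conj x)⁻¹ * T⁻¹ * r) = r := fun r => by field_simp
    rw [h6, h7] at h5
    exact h5.symm

/-- The integral equation is equivalent to an operator equation in `L²(ℝ)`. -/
theorem isSolution_iff (hω₀ : 0 < ω₀) (hT : 0 < T) {φ : ℝ → ℝ} {u : Lp ℝ 2 (volume : Measure ℝ)}
    (hu : u =ᵐ[volume] fun x => conj x * φ (T * x)) :
    IsSolution ω₀ εF T φ ↔
      collisionOp u - (T * (1 / (2 * εF))) • scatOp one_le_two u
        + (T ^ 2 * (1 / (2 * ω₀ ^ 2))) • scatOp (le_refl 2) u = (ω₀ ^ 2 / T ^ 3) • sourceL := by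
  have hmem : MemLp φ 2 (sigma ω₀ T) := (memLp_sigma_iff hω₀ hT).mpr ((Lp.memLp u).ae_eq hu)
  have hS : ∀ {j : ℕ} (hj : j ≤ 2), ∀ᵐ x, Integrable (fun y => symKernel j x y * u y) :=
    fun hj => ((convDominated_symKernel hj).ae_integrable_and_sq_le (Lp.memLp u)).mono
      fun x hx => hx.1
  have hint : ∀ᵐ x, Integrable (fun v => K ω₀ εF T (T * x) v * φ v) ∧
      conj x * ∫ v, K ω₀ εF T (T * x) v * φ v
        = (∫ y, symKernel 0 x y * u y) + T * (1 / (2 * εF)) * (∫ y, symKernel 1 x y * u y)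
          - T ^ 2 * (1 / (2 * ω₀ ^ 2)) * ∫ y, symKernel 2 x y * u y := by
    filter_upwards [hS (Nat.zero_le 2), hS one_le_two, hS (le_refl 2)] with x h0 h1 h2
    exact integral_K_mul hω₀ hT hu h0 h1 h2
  -- The membership and integrability requirements hold automatically for a `φ` that comes from
  -- `L²(ℝ)`.
  have h1 : IsSolution ω₀ εF T φ ↔
      ∀ᵐ ε, φ ε = 1 / Gamma0 ω₀ T ε + ∫ v, K ω₀ εF T ε v * φ v :=
    ⟨fun h => h.equation, fun h => ⟨hmem, (ae_mul_left_iff hT.ne').mp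
      (hint.mono fun x hx => hx.1), h⟩⟩
  rw [h1, ← ae_mul_left_iff hT.ne', Lp.ext_iff]
  refine eventually_congr ?_
  filter_upwards [hint, hu, coeFn_sourceL,
    Lp.coeFn_smul (ω₀ ^ 2 / T ^ 3) sourceL,
    Lp.coeFn_add (collisionOp u - (T * (1 / (2 * εF))) • scatOp one_le_two u)
      ((T ^ 2 * (1 / (2 * ω₀ ^ 2))) • scatOp (le_refl 2) u),
    Lp.coeFn_sub (collisionOp u) ((T * (1 / (2 * εF))) • scatOp one_le_two u),
    Lp.coeFn_smul (T * (1 / (2 * εF))) (scatOp one_le_two u),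
    Lp.coeFn_smul (T ^ 2 * (1 / (2 * ω₀ ^ 2))) (scatOp (le_refl 2) u),
    Lp.coeFn_sub u (scatOp (Nat.zero_le 2) u),
    (convDominated_symKernel (Nat.zero_le 2)).coeFn_op u,
    (convDominated_symKernel one_le_two).coeFn_op u,
    (convDominated_symKernel (le_refl 2)).coeFn_op u]
    with x e0 e1 e2 e3 e4 e5 e6 e7 e8 e9 e10 e11
  rw [e3, Pi.smul_apply, e2, e4, Pi.add_apply, e5, Pi.sub_apply, e6, e7, Pi.smul_apply,
    Pi.smul_apply, collisionOp_apply, e8, Pi.sub_apply]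
  simp only [scatOp, e9, e10, e11, smul_eq_mul]
  have hc := (conj_pos x).ne'
  have hsrc : conj x * (1 / Gamma0 ω₀ T (T * x)) = ω₀ ^ 2 / T ^ 3 * source x := by
    have hr : √(rate x) ^ 2 = rate x := Real.sq_sqrt (rate_pos x).le
    have hg := (sqrt_rate_pos x).ne'
    rw [Gamma0_eq hω₀ hT, conj, source]
    generalize √(rate x) = g at hr hg ⊢
    rw [← hr]
    field_simp
  rw [← mul_right_inj' hc, ← e1, mul_add, hsrc, e0.2]
  constructor <;> intro h <;> linarith

end Scaling

/-! ### Leading contributions as limits in `L²(ℝ)` -/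

section LeadingTerm

theorem coeFn_const_smul_eq {X : Lp ℝ 2 (volume : Measure ℝ)} {Φ : ℝ → ℝ}
    (hX : X =ᵐ[volume] fun x => conj x * Φ x) {T : ℝ} (hT : 0 < T) (a : ℝ) :
    (a • X : Lp ℝ 2 (volume : Measure ℝ)) =ᵐ[volume]
      fun x => conj x * (a * Φ (T * x / T)) := by
  filter_upwards [hX, Lp.coeFn_smul a X] with x h1 h2
  rw [h2, Pi.smul_apply, h1, mul_div_cancel_left₀ _ hT.ne', smul_eq_mul]
  ring

/-- The definition of the leading term, in terms of convergence in the fixed space `L²(ℝ)`. -/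
theorem hasLeadingTerm_iff {ω₀ : ℝ} (hω₀ : 0 < ω₀) {f : ℝ → ℝ → ℝ} {n : ℝ} {Φ : ℝ → ℝ}
    {F : ℝ → Lp ℝ 2 (volume : Measure ℝ)} {X : Lp ℝ 2 (volume : Measure ℝ)}
    (hF : ∀ᶠ T in 𝓝[>] (0 : ℝ), F T =ᵐ[volume] fun x => conj x * f T (T * x))
    (hX : X =ᵐ[volume] fun x => conj x * Φ x) :
    HasLeadingTerm ω₀ f n Φ ↔
      X ≠ 0 ∧ Tendsto (fun T : ℝ => T ^ (-n) • F T) (𝓝[>] 0) (𝓝 X) := by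
  have hmem : ∀ T : ℝ, 0 < T → MemLp (fun ε => T ^ n * Φ (ε / T)) 2 (sigma ω₀ T) := fun T hT =>
    (memLp_sigma_iff hω₀ hT).mpr ((Lp.memLp (T ^ n • X)).ae_eq (coeFn_const_smul_eq hX hT _))
  have hnull : ¬ Φ =ᵐ[volume] 0 ↔ X ≠ 0 := by
    refine not_congr ?_
    rw [Lp.eq_zero_iff_ae_eq_zero]
    refine eventually_congr ?_
    filter_upwards [hX] with x hx
    rw [hx]
    simp [(conj_pos x).ne']
  have key : X ≠ 0 → (Tendsto (fun T : ℝ => eLpNorm (fun ε => f T ε - T ^ n * Φ (ε / T)) 2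
      (sigma ω₀ T) / eLpNorm (fun ε => T ^ n * Φ (ε / T)) 2 (sigma ω₀ T)) (𝓝[>] 0) (𝓝 0) ↔
      Tendsto (fun T : ℝ => T ^ (-n) • F T) (𝓝[>] 0) (𝓝 X)) := by
    intro hX0
    have hXn : 0 < ‖X‖ := norm_pos_iff.mpr hX0
    -- The scalar prefactor of the norm and the power `T ^ n` both cancel, leaving a relative error
    -- in a fixed Hilbert space.
    have hev : (fun T : ℝ => eLpNorm (fun ε => f T ε - T ^ n * Φ (ε / T)) 2
        (sigma ω₀ T) / eLpNorm (fun ε => T ^ n * Φ (ε / T)) 2 (sigma ω₀ T)) =ᶠ[𝓝[>] 0]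
        fun T => ENNReal.ofReal (‖T ^ (-n) • F T - X‖ / ‖X‖) := by
      filter_upwards [hF, self_mem_nhdsWithin] with T hFT hT0
      have hT : 0 < T := hT0
      have hTn : 0 < T ^ n := Real.rpow_pos_of_pos hT n
      have e1 : eLpNorm (fun x => conj x * (f T (T * x) - T ^ n * Φ (T * x / T))) 2 volume
          = ENNReal.ofReal (T ^ n * ‖T ^ (-n) • F T - X‖) := by
        have h1 : T ^ n * ‖T ^ (-n) • F T - X‖ = ‖F T - T ^ n • X‖ := by
          rw [← Real.norm_of_nonneg hTn.le, ← norm_smul, smul_sub, smul_smul,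
            Real.norm_of_nonneg hTn.le, ← Real.rpow_add hT, add_neg_cancel, Real.rpow_zero,
            one_smul]
        rw [h1, ofReal_norm, Lp.enorm_def]
        refine eLpNorm_congr_ae ?_
        filter_upwards [hFT, coeFn_const_smul_eq hX hT (T ^ n), Lp.coeFn_sub (F T) (T ^ n • X)]
          with x h2 h3 h4
        rw [h4, Pi.sub_apply, h2, h3]
        ring
      have e2 : eLpNorm (fun x => conj x * (T ^ n * Φ (T * x / T))) 2 volume
          = ENNReal.ofReal (T ^ n * ‖X‖) := by
        rw [← Real.norm_of_nonneg hTn.le, ← norm_smul, ofReal_norm, Lp.enorm_def,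
          Real.norm_of_nonneg hTn.le]
        exact eLpNorm_congr_ae (coeFn_const_smul_eq hX hT (T ^ n)).symm
      rw [eLpNorm_sigma hω₀ hT, eLpNorm_sigma hω₀ hT, e1, e2,
        ← ENNReal.ofReal_mul (by positivity), ← ENNReal.ofReal_mul (by positivity),
        ← ENNReal.ofReal_div_of_pos (by positivity)]
      congr 1
      field_simp
    rw [tendsto_congr' hev, tendsto_iff_norm_sub_tendsto_zero]
    constructor
    · intro h
      have h1 := (ENNReal.tendsto_toReal ENNReal.zero_ne_top).comp h
      have h2 := h1.mul_const ‖X‖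
      simp only [ENNReal.toReal_zero, zero_mul] at h2
      refine h2.congr fun T => ?_
      simp only [Function.comp]
      rw [ENNReal.toReal_ofReal (by positivity), div_mul_cancel₀ _ hXn.ne']
    · intro h
      have h1 := ENNReal.tendsto_ofReal (h.div_const ‖X‖)
      simpa using h1
  constructor
  · intro h
    have h0 := hnull.mp h.not_null
    exact ⟨h0, (key h0).mp h.tendsto⟩
  · rintro ⟨h0, h⟩
    exact ⟨hmem, hnull.mpr h0, (key h0).mpr h⟩

theorem exists_Lp_of_hasLeadingTerm {ω₀ : ℝ} (hω₀ : 0 < ω₀) {f : ℝ → ℝ → ℝ} {n : ℝ} {Φ : ℝ → ℝ}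
    (h : HasLeadingTerm ω₀ f n Φ) :
    ∃ X : Lp ℝ 2 (volume : Measure ℝ), X =ᵐ[volume] fun x => conj x * Φ x := by
  have h1 := (memLp_sigma_iff hω₀ one_pos).mp (h.memLp 1 one_pos)
  simp only [Real.one_rpow, one_mul, div_one] at h1
  exact ⟨h1.toLp, h1.coeFn_toLp⟩

/-- If `m < n`, then `T^(-m) F = T^(n-m) T^(-n) F` tends to zero, contrary to `Y ≠ 0`. -/
theorem le_of_tendsto_rpow_smul {E : Type*} [NormedAddCommGroup E] [NormedSpace ℝ E] {F : ℝ → E}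
    {n m : ℝ} {X Y : E} (hY : Y ≠ 0)
    (hn : Tendsto (fun T : ℝ => T ^ (-n) • F T) (𝓝[>] 0) (𝓝 X))
    (hm : Tendsto (fun T : ℝ => T ^ (-m) • F T) (𝓝[>] 0) (𝓝 Y)) : n ≤ m := by
  by_contra! hlt
  have h1 : Tendsto (fun T : ℝ => T ^ (n - m)) (𝓝[>] 0) (𝓝 0) := by
    have h2 := (Real.continuousAt_rpow_const 0 (n - m) (Or.inr (by linarith))).tendsto
    rw [Real.zero_rpow (by linarith)] at h2
    exact h2.mono_left nhdsWithin_le_nhds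
  have h3 := h1.smul hn
  rw [zero_smul] at h3
  refine hY (tendsto_nhds_unique (hm.congr' ?_) h3)
  filter_upwards [self_mem_nhdsWithin] with T hT
  have hT' : 0 < T := hT
  rw [smul_smul, ← Real.rpow_add hT']
  congr 2
  ring

theorem HasLeadingTerm.unique {ω₀ : ℝ} (hω₀ : 0 < ω₀) {f : ℝ → ℝ → ℝ} {n m : ℝ} {Φ Ψ : ℝ → ℝ}
    {F : ℝ → Lp ℝ 2 (volume : Measure ℝ)}
    (hF : ∀ᶠ T in 𝓝[>] (0 : ℝ), F T =ᵐ[volume] fun x => conj x * f T (T * x))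
    (hn : HasLeadingTerm ω₀ f n Φ) (hm : HasLeadingTerm ω₀ f m Ψ) :
    n = m ∧ Φ =ᵐ[volume] Ψ := by
  obtain ⟨X, hX⟩ := exists_Lp_of_hasLeadingTerm hω₀ hn
  obtain ⟨Y, hY⟩ := exists_Lp_of_hasLeadingTerm hω₀ hm
  obtain ⟨hX0, hXt⟩ := (hasLeadingTerm_iff hω₀ hF hX).mp hn
  obtain ⟨hY0, hYt⟩ := (hasLeadingTerm_iff hω₀ hF hY).mp hm
  obtain rfl : n = m :=
    le_antisymm (le_of_tendsto_rpow_smul hY0 hXt hYt) (le_of_tendsto_rpow_smul hX0 hYt hXt)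
  obtain rfl := tendsto_nhds_unique hXt hYt
  refine ⟨rfl, ?_⟩
  filter_upwards [hX, hY] with x h1 h2
  rw [h1] at h2
  exact mul_left_cancel₀ (conj_pos x).ne' h2

end LeadingTerm

/-! ### Existence and uniqueness at low temperature -/

theorem exists_unique_solution {ω₀ εF : ℝ} (hω₀ : 0 < ω₀) :
    ∃ T₀ : ℝ, 0 < T₀ ∧ ∀ T : ℝ, 0 < T → T < T₀ →
      ∃ φ : ℝ → ℝ, IsSolution ω₀ εF T φ ∧
        ∀ ψ : ℝ → ℝ, IsSolution ω₀ εF T ψ → ψ =ᵐ[volume] φ := by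
  obtain ⟨κ, hκ, hgap⟩ := exists_spectral_gap
  obtain ⟨s₀, hs₀, hbij⟩ := exists_bijective_of_gap collisionOp (scatOp (le_refl 2)) oneL hκ hgap
    inner_scatOp_two_oneL_pos
  have hβ : 0 < 1 / (2 * ω₀ ^ 2) := by positivity
  -- Only the second-order term, with `s = T² / (2 ω₀²)`, has to be small; the first-order term is
  -- skew.
  refine ⟨√(s₀ / (1 / (2 * ω₀ ^ 2))), by positivity, fun T hT hTT => ?_⟩
  have hs : T ^ 2 * (1 / (2 * ω₀ ^ 2)) < s₀ := by
    have := (Real.lt_sqrt hT.le).mp hTT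
    rwa [lt_div_iff₀ hβ] at this
  have hskew : ∀ u, inner ℝ ((-(T * (1 / (2 * εF))) • scatOp one_le_two) u) u = 0 := fun u => by
    have h1 := inner_scatOp_comm one_le_two u u
    rw [real_inner_comm, pow_one] at h1
    rw [_root_.smul_apply, inner_smul_left, real_inner_comm]
    have h2 : inner ℝ u (scatOp one_le_two u) = 0 := by linarith
    rw [h2, mul_zero]
  have hb := hbij _ (by positivity) hs _ hskew
  have happ : ∀ u, (collisionOp + (-(T * (1 / (2 * εF))) • scatOp one_le_two)
      + (T ^ 2 * (1 / (2 * ω₀ ^ 2))) • scatOp (le_refl 2)) u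
      = collisionOp u - (T * (1 / (2 * εF))) • scatOp one_le_two u
        + (T ^ 2 * (1 / (2 * ω₀ ^ 2))) • scatOp (le_refl 2) u := fun u => by
    rw [_root_.add_apply, _root_.add_apply, _root_.smul_apply, _root_.smul_apply, neg_smul,
      ← sub_eq_add_neg]
  obtain ⟨u, hu⟩ := hb.2 ((ω₀ ^ 2 / T ^ 3) • sourceL)
  have huφ : u =ᵐ[volume] fun x => conj x * (fun ε => u (ε / T) / conj (ε / T)) (T * x) := by
    refine Eventually.of_forall fun x => ?_
    simp only [mul_div_cancel_left₀ _ hT.ne']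
    rw [mul_div_cancel₀ _ (conj_pos x).ne']
  refine ⟨fun ε => u (ε / T) / conj (ε / T), ?_, fun ψ hψ => ?_⟩
  · rw [isSolution_iff hω₀ hT huφ, ← happ]
    exact hu
  · have hmem := (memLp_sigma_iff hω₀ hT).mp hψ.memLp
    have h1 := (isSolution_iff hω₀ hT hmem.coeFn_toLp).mp hψ
    rw [← happ, ← hu] at h1
    have h2 := hb.1 h1
    refine (ae_mul_left_iff hT.ne').mp ?_
    have h3 := hmem.coeFn_toLp
    rw [h2] at h3
    filter_upwards [h3, huφ] with x e1 e2
    rw [e2] at e1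
    exact (mul_left_cancel₀ (conj_pos x).ne' e1).symm

end ElectronPhonon

end

/-! ### Leading contributions to the even and odd parts -/

noncomputable section

namespace ElectronPhonon

open Classical in
/-- A family of functions at temperature `T`, as elements of `L²(ℝ)`. -/
def rescaledL (T : ℝ) (φ : ℝ → ℝ) : Lp ℝ 2 (volume : Measure ℝ) :=
  if h : MemLp (fun x => conj x * φ (T * x)) 2 volume then h.toLp _ else 0

theorem coeFn_rescaledL {ω₀ T : ℝ} (hω₀ : 0 < ω₀) (hT : 0 < T) {φ : ℝ → ℝ}
    (h : MemLp φ 2 (sigma ω₀ T)) : rescaledL T φ =ᵐ[volume] fun x => conj x * φ (T * x) := by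
  have h1 := (memLp_sigma_iff hω₀ hT).mp h
  rw [rescaledL, dif_pos h1]
  exact h1.coeFn_toLp

theorem coeFn_half_add_reflection {T : ℝ} {φ : ℝ → ℝ} {u : Lp ℝ 2 (volume : Measure ℝ)}
    (hu : u =ᵐ[volume] fun x => conj x * φ (T * x)) :
    ((1 / 2 : ℝ) • (u + reflection u) : Lp ℝ 2 (volume : Measure ℝ)) =ᵐ[volume]
      fun x => conj x * evenPart φ (T * x) := by
  filter_upwards [hu, ae_neg hu, coeFn_reflection u, Lp.coeFn_add u (reflection u),
    Lp.coeFn_smul (1 / 2 : ℝ) (u + reflection u)] with x h1 h2 h3 h4 h5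
  rw [h5, Pi.smul_apply, h4, Pi.add_apply, h3, h2, h1, conj_neg, evenPart, smul_eq_mul, mul_neg]
  ring

theorem coeFn_half_sub_reflection {T : ℝ} {φ : ℝ → ℝ} {u : Lp ℝ 2 (volume : Measure ℝ)}
    (hu : u =ᵐ[volume] fun x => conj x * φ (T * x)) :
    ((1 / 2 : ℝ) • (u - reflection u) : Lp ℝ 2 (volume : Measure ℝ)) =ᵐ[volume]
      fun x => conj x * oddPart φ (T * x) := by
  filter_upwards [hu, ae_neg hu, coeFn_reflection u, Lp.coeFn_sub u (reflection u),
    Lp.coeFn_smul (1 / 2 : ℝ) (u - reflection u)] with x h1 h2 h3 h4 h5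
  rw [h5, Pi.smul_apply, h4, Pi.sub_apply, h3, h2, h1, conj_neg, oddPart, smul_eq_mul, mul_neg]
  ring

theorem tendsto_of_norm_sub_le {E : Type*} [NormedAddCommGroup E] {G : ℝ → E} {X : E} {C : ℝ}
    (h : ∀ᶠ T in 𝓝[>] (0 : ℝ), ‖G T - X‖ ≤ C * T) : Tendsto G (𝓝[>] 0) (𝓝 X) := by
  rw [tendsto_iff_norm_sub_tendsto_zero]
  have h1 : Tendsto (fun T : ℝ => C * T) (𝓝[>] 0) (𝓝 0) := by
    have h2 : Tendsto (fun T : ℝ => C * T) (𝓝 0) (𝓝 (C * 0)) :=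
      (continuous_const_mul C).tendsto 0
    rw [mul_zero] at h2
    exact h2.mono_left nhdsWithin_le_nhds
  exact squeeze_zero' (Eventually.of_forall fun T => norm_nonneg _) h h1

theorem exists_leading_terms {ω₀ εF : ℝ} (hω₀ : 0 < ω₀) (hεF : 0 < εF) :
    ∃ (c : ℝ) (χ : ℝ → ℝ), ∀ φ : ℝ → ℝ → ℝ,
      (∀ᶠ T in 𝓝[>] (0 : ℝ), IsSolution ω₀ εF T (φ T)) →
        HasLeadingTerm ω₀ (fun T => evenPart (φ T)) (-5) (fun _ => c) ∧
        HasLeadingTerm ω₀ (fun T => oddPart (φ T)) (-4) χ := by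
  obtain ⟨κ, hκ, hgap⟩ := exists_spectral_gap
  obtain ⟨c, χ, C, T₀, hc, hχ, -, hT₀, hexp⟩ := exists_leading_order collisionOp
    (scatOp one_le_two) (scatOp (le_refl 2)) reflection oneL ((ω₀ ^ 2) • sourceL) hκ
    (by positivity : 0 < 1 / (2 * εF)) (by positivity : 0 < 1 / (2 * ω₀ ^ 2)) hgap
    inner_collisionOp_comm collisionOp_oneL
    (fun u v => by rw [inner_scatOp_comm, pow_one, neg_one_mul]) scatOp_one_oneL_ne_zero
    inner_scatOp_two_oneL_pos
    (by rw [inner_smul_right]; exact mul_pos (by positivity) inner_oneL_sourceL_pos)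
    (fun u => (norm_reflection u).le) reflection_oneL reflection_reflection reflection_collisionOp
    (fun u => by rw [reflection_scatOp, pow_one, neg_one_smul])
  refine ⟨c, fun x => χ x / conj x, fun φ hφ => ?_⟩
  have hF : ∀ᶠ T in 𝓝[>] (0 : ℝ),
      rescaledL T (φ T) =ᵐ[volume] fun x => conj x * φ T (T * x) := by
    filter_upwards [hφ, self_mem_nhdsWithin] with T h1 hT
    exact coeFn_rescaledL hω₀ hT h1.memLp
  set F : ℝ → Lp ℝ 2 (volume : Measure ℝ) := fun T => rescaledL T (φ T) with hFdef
  have hest : ∀ᶠ T in 𝓝[>] (0 : ℝ), 0 < T ∧ ‖T ^ 5 • F T - c • oneL‖ ≤ C * T ∧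
      ‖(1 / 2 : ℝ) • (T ^ 5 • F T - reflection (T ^ 5 • F T)) - T • χ‖ ≤ C * T ^ 2 := by
    filter_upwards [hφ, hF, self_mem_nhdsWithin, Ioo_mem_nhdsGT hT₀] with T h1 h2 hT hTT
    refine ⟨hT, hexp T hT hTT.2 _ ?_⟩
    have hT' : T ≠ 0 := (Set.mem_Ioi.mp hT).ne'
    -- The factor `T⁵` turns the source `ω₀² / T³` into `T² ω₀²`, the normalization of the abstract
    -- expansion.
    have h3 := congrArg (fun v => T ^ 5 • v) ((isSolution_iff hω₀ hT h2).mp h1)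
    simp only [smul_add, smul_sub, smul_smul] at h3
    simp only [map_smul, smul_smul]
    rw [mul_comm _ (T ^ 5), mul_comm _ (T ^ 5), h3]
    congr 1
    field_simp
  constructor
  · refine (hasLeadingTerm_iff hω₀ (F := fun T => (1 / 2 : ℝ) • (F T + reflection (F T)))
      (X := c • oneL) (hF.mono fun T h => coeFn_half_add_reflection h) ?_).mpr ⟨?_, ?_⟩
    · filter_upwards [coeFn_oneL, Lp.coeFn_smul c oneL] with x h1 h2
      rw [h2, Pi.smul_apply, h1, smul_eq_mul, mul_comm]
    · refine smul_ne_zero hc.ne' fun h => ?_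
      have := inner_oneL_sourceL_pos
      rw [h, inner_zero_left] at this
      exact lt_irrefl _ this
    · refine tendsto_of_norm_sub_le (C := C) (hest.mono fun T hT => le_trans ?_ hT.2.1)
      have h5 : T ^ (-(-5 : ℝ)) = T ^ 5 := by
        rw [neg_neg]; exact_mod_cast Real.rpow_natCast T 5
      have h6 : T ^ (-(-5 : ℝ)) • ((1 / 2 : ℝ) • (F T + reflection (F T))) - c • oneL
          = (1 / 2 : ℝ) • ((T ^ 5 • F T - c • oneL)
            + reflection (T ^ 5 • F T - c • oneL)) := by
        rw [h5, map_sub, map_smul, map_smul, reflection_oneL]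
        module
      rw [h6, norm_smul]
      have h7 := norm_add_le (T ^ 5 • F T - c • oneL) (reflection (T ^ 5 • F T - c • oneL))
      rw [norm_reflection] at h7
      rw [Real.norm_of_nonneg (by norm_num : (0 : ℝ) ≤ 1 / 2)]
      linarith
  · refine (hasLeadingTerm_iff hω₀ (F := fun T => (1 / 2 : ℝ) • (F T - reflection (F T)))
      (X := χ) (hF.mono fun T h => coeFn_half_sub_reflection h) ?_).mpr ⟨hχ, ?_⟩
    · exact Eventually.of_forall fun x => (mul_div_cancel₀ _ (conj_pos x).ne').symm
    · refine tendsto_of_norm_sub_le (C := C) (hest.mono fun T hT => ?_)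
      obtain ⟨hT0, -, h1⟩ := hT
      have h4 : T ^ (-(-4 : ℝ)) = T ^ 4 := by
        rw [neg_neg]; exact_mod_cast Real.rpow_natCast T 4
      -- Dividing the `C T²` bound for the odd part by `T` still leaves an error of order `T`.
      have h6 : (1 / 2 : ℝ) • (T ^ 5 • F T - reflection (T ^ 5 • F T)) - T • χ
          = T • (T ^ (-(-4 : ℝ)) • ((1 / 2 : ℝ) • (F T - reflection (F T))) - χ) := by
        rw [h4, map_smul]
        module
      rw [h6, norm_smul, Real.norm_of_nonneg hT0.le] at h1
      refine le_of_mul_le_mul_left (h1.trans_eq ?_) hT0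
      ring

end ElectronPhonon

end

theorem lemma3p3 (ω₀ εF : ℝ) (hω₀ : 0 < ω₀) (hεF : 0 < εF) :
    -- at low temperature the integral equation has exactly one solution
    (∃ T₀ : ℝ, 0 < T₀ ∧ ∀ T : ℝ, 0 < T → T < T₀ →
      ∃ φ : ℝ → ℝ, ElectronPhonon.IsSolution ω₀ εF T φ ∧
        ∀ ψ : ℝ → ℝ, ElectronPhonon.IsSolution ω₀ εF T ψ → ψ =ᵐ[volume] φ) ∧
    ∃ (c : ℝ) (χ : ℝ → ℝ), ∀ φ : ℝ → ℝ → ℝ,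
      (∀ᶠ T in 𝓝[>] (0 : ℝ), ElectronPhonon.IsSolution ω₀ εF T (φ T)) →
        -- the leading contribution to the even part is the constant function `c T⁻⁵`
        ElectronPhonon.HasLeadingTerm ω₀ (fun T => ElectronPhonon.evenPart (φ T)) (-5)
          (fun _ => c) ∧
        -- the leading contribution to the odd part is `T⁻⁴ χ(ε/T)`
        ElectronPhonon.HasLeadingTerm ω₀ (fun T => ElectronPhonon.oddPart (φ T)) (-4) χ ∧
        -- and these exponents and the constancy are forced
        ∀ (np nm : ℝ) (Φp Φm : ℝ → ℝ),
          ElectronPhonon.HasLeadingTerm ω₀ (fun T => ElectronPhonon.evenPart (φ T)) (-np) Φp →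
          ElectronPhonon.HasLeadingTerm ω₀ (fun T => ElectronPhonon.oddPart (φ T)) (-nm) Φm →
            np = nm + 1 ∧ np = 5 ∧ Φp =ᵐ[volume] fun _ => c := by
  refine ⟨ElectronPhonon.exists_unique_solution hω₀, ?_⟩
  obtain ⟨c, χ, h⟩ := ElectronPhonon.exists_leading_terms hω₀ hεF
  refine ⟨c, χ, fun φ hφ => ?_⟩
  obtain ⟨hp, hm⟩ := h φ hφ
  refine ⟨hp, hm, fun np nm Φp Φm hnp hnm => ?_⟩
  have hF : ∀ᶠ T in 𝓝[>] (0 : ℝ),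
      ElectronPhonon.rescaledL T (φ T) =ᵐ[volume] fun x => ElectronPhonon.conj x * φ T (T * x) := by
    filter_upwards [hφ, self_mem_nhdsWithin] with T h1 hT
    exact ElectronPhonon.coeFn_rescaledL hω₀ hT h1.memLp
  obtain ⟨h1, h2⟩ := ElectronPhonon.HasLeadingTerm.unique hω₀
    (hF.mono fun T h => ElectronPhonon.coeFn_half_add_reflection h) hnp hp
  obtain ⟨h3, -⟩ := ElectronPhonon.HasLeadingTerm.unique hω₀
    (hF.mono fun T h => ElectronPhonon.coeFn_half_sub_reflection h) hnm hm
  exact ⟨by linarith, by linarith, h2⟩
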